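/- Let $p\ge 1$, let $\Lambda=(\mathbb Z/p\mathbb Z)^2$, and index $p\times p$ real matrices $\theta$ by $\Lambda$ (coordinates modulo $p$). Let $C(\theta)$ be the $\Lambda\times\Lambda$ matrix $C(\theta)[x,y]=\theta[y-x]$. Let $\Theta$ be the space of $\theta$ with $\theta[0,0]=0$ and $\theta[x]=\theta[-x]$ for all $x\in\Lambda$, and let $\Theta^+$ be the set of $\theta\in\Theta$ such that $I_{p^2}-C(\theta)$ is positive definite. Write $\varphi_{\min}$, $\varphi_{\max}$ for the smallest and largest eigenvalue of a symmetric matrix and $\|\theta\|_1=\sum_{x\in\Lambda}|\theta[x]|$. For $i,j\in\{0,\dots,p-1\}$ set $|(i,j)|_t^2=\min(i,p-i)^2+\min(j,p-j)^2$. The collection $\mathcal M_1$ of models consists of $\emptyset$ and of all sets $m=\{x\in\Lambda\setminus\{(0,0)\}: |x|_t\le r\}$ with $r>1$. For $m\in\mathcal M_1$, let $\Theta_m$ be the space of $\theta\in\Theta$ supported in $m$, $d_m=\dim\Theta_m$, $\Theta_m^+=\Theta_m\cap\Theta^+$, and for $\rho_1\ge 2$ let $\Theta^+_{m,\rho_1}=\{\theta\in\Theta^+_m:\varphi_{\max}(I_{p^2}-C(\theta))<\rho_1\}$,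 with closure $\overline{\Theta^+_{m,\rho_1}}$. For $\theta\in\Theta^+$ and $\sigma>0$, let $\mathbf X_1,\dots,\mathbf X_n$ ($n\ge1$) be i.i.d. centered Gaussian fields on $\Lambda$ with covariance matrix $\Sigma=\sigma^2(I_{p^2}-C(\theta))^{-1}$, and let $\mathbb E_\theta$ be the corresponding expectation. Define the loss $$l(\theta_1,\theta_2)=\frac1{p^2}\operatorname{tr}\big[(C(\theta_1)-C(\theta_2))\,\Sigma\,(C(\theta_1)-C(\theta_2))\big],$$ the criterion $$\gamma_{n,p}(\theta')=\frac1{np^2}\sum_{i=1}^n\sum_{x\in\Lambda}\Big(\mathbf X_i[x]-\sum_{y\in\Lambda\setminus\{(0,0)\}}\theta'[y]\,\mathbf X_i[x+y]\Big)^2,$$ the conditional least squares estimator $\widehat\theta_{m,\rho_1}=\arg\min_{\theta'\in\overline{\Theta^+_{m,\rho_1}}}\gamma_{n,p}(\theta')$ (almost surely unique) and the projection $\theta_{m,\rho_1}=\arg\min_{\theta'\in\overline{\Theta^+_{m,\rho_1}}}l(\theta',\theta)$. There is a universal constant $L>0$ such that the following holds for all $p\ge1$, $\sigma>0$, $\rho_1\ge2$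 and $m\in\mathcal M_1$. (1) If $\theta\in\Theta_m^+$ satisfies $(\mathbb H_1)$: $\varphi_{\max}(I_{p^2}-C(\theta))<\rho_1$, then $l(\widehat\theta_{m,\rho_1},\theta)$ is integrable for every $n\ge1$, the following limit exists and is finite, and $$\lim_{n\to+\infty}np^2\,\mathbb E_\theta\big[l(\widehat\theta_{m,\rho_1},\theta)\big]\ \ge\ L\sigma^2\varphi_{\min}\big[I_{p^2}-C(\theta)\big]\,d_m=L\sigma^4\frac{d_m}{\varphi_{\max}(\Sigma)}.$$ (2) If $\theta\in\Theta^+$ satisfies $(\mathbb H_2)$: $\|\theta\|_1<1$, then $l(\widehat\theta_{m,\rho_1},\theta_{m,\rho_1})$ is integrable for every $n\ge1$, the following limit exists and is finite, and $$\lim_{n\to+\infty}np^2\,\mathbb E_\theta\big[l(\widehat\theta_{m,\rho_1},\theta_{m,\rho_1})\big]\ \ge\ L\sigma^2\big(1-\|\theta\|_1\big)^3d_m.$$ -/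

import Mathlib

open MeasureTheory ProbabilityTheory Filter Topology

namespace TorusGMRF

noncomputable section

/-- The toroidal lattice of size `p × p`; coordinates are taken modulo `p`. -/
abbrev Lattice (p : ℕ) : Type := ZMod p × ZMod p

/-- The space of `p × p` matrices, indexed by the nodes of the lattice modulo `p`. -/
abbrev Param (p : ℕ) : Type := Lattice p → ℝ

/-- The block circulant matrix `C(θ)`: its entry at the nodes `(x, y)` is `θ[y - x]`. -/
def circ {p : ℕ} (θ : Param p) : Matrix (Lattice p) (Lattice p) ℝ :=
  Matrix.of fun x y => θ (y - x)

/-- Largest eigenvalue (used for symmetric matrices only). -/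
def phiMax {ι : Type*} [Fintype ι] [DecidableEq ι] (A : Matrix ι ι ℝ) : ℝ :=
  sSup (spectrum ℝ A)

/-- Smallest eigenvalue (used for symmetric matrices only). -/
def phiMin {ι : Type*} [Fintype ι] [DecidableEq ι] (A : Matrix ι ι ℝ) : ℝ :=
  sInf (spectrum ℝ A)

/-- The `l₁` norm: sum of the absolute values of the entries. -/
def l1norm {p : ℕ} [NeZero p] (θ : Param p) : ℝ := ∑ x, |θ x|

/-- The vector space `Θ`: `θ[0,0] = 0` and `θ[i,j] = θ[-i,-j]`. -/
def Theta (p : ℕ) : Submodule ℝ (Param p) where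
  carrier := {θ | θ 0 = 0 ∧ ∀ x, θ (-x) = θ x}
  add_mem' := by
    rintro a b ⟨ha, ha'⟩ ⟨hb, hb'⟩
    exact ⟨by simp [ha, hb], fun x => by simp [ha', hb']⟩
  zero_mem' := ⟨rfl, fun _ => rfl⟩
  smul_mem' := by
    rintro c a ⟨ha, ha'⟩
    exact ⟨by simp [ha], fun x => by simp [ha']⟩

/-- The set `Θ⁺` of those `θ ∈ Θ` for which `I - C(θ)` is positive definite. -/
def ThetaPlus (p : ℕ) [NeZero p] : Set (Param p) :=
  {θ | θ ∈ Theta p ∧ (1 - circ θ).PosDef}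

/-- Squared toroidal norm of a node. -/
def torNormSq {p : ℕ} (x : Lattice p) : ℕ :=
  (min x.1.val (p - x.1.val)) ^ 2 + (min x.2.val (p - x.2.val)) ^ 2

/-- The collection `𝓜₁` of models: the empty neighbourhood and the punctured toroidal balls
of radius `r > 1`. -/
def IsModel {p : ℕ} (m : Set (Lattice p)) : Prop :=
  m = ∅ ∨ ∃ r : ℝ, 1 < r ∧ m = {x | x ≠ 0 ∧ Real.sqrt (torNormSq x : ℝ) ≤ r}

/-- `Θ_m`: the elements of `Θ` whose support is included in `m`. -/
def ThetaModel {p : ℕ} (m : Set (Lattice p)) : Submodule ℝ (Param p) where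
  carrier := {θ | θ ∈ Theta p ∧ ∀ x, x ∉ m → θ x = 0}
  add_mem' := by
    rintro a b ⟨ha, ha'⟩ ⟨hb, hb'⟩
    exact ⟨add_mem ha hb, fun x hx => by simp [ha' x hx, hb' x hx]⟩
  zero_mem' := ⟨zero_mem _, fun _ _ => rfl⟩
  smul_mem' := by
    rintro c a ⟨ha, ha'⟩
    exact ⟨Submodule.smul_mem _ c ha, fun x hx => by simp [ha' x hx]⟩

/-- The dimension `d_m` of `Θ_m`. -/
def dimModel {p : ℕ} (m : Set (Lattice p)) : ℕ := Module.finrank ℝ (ThetaModel m)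

/-- `Θ_m⁺ = Θ_m ∩ Θ⁺`. -/
def ThetaModelPlus {p : ℕ} [NeZero p] (m : Set (Lattice p)) : Set (Param p) :=
  (ThetaModel m : Set (Param p)) ∩ ThetaPlus p

/-- `Θ⁺_{m,ρ₁}`: the elements of `Θ_m⁺` such that the largest eigenvalue of `I - C(θ)` is
less than `ρ₁`. -/
def ThetaModelPlusRho {p : ℕ} [NeZero p] (m : Set (Lattice p)) (ρ₁ : ℝ) : Set (Param p) :=
  {θ | θ ∈ ThetaModelPlus m ∧ phiMax (1 - circ θ) < ρ₁}

/-- The covariance matrix `Σ = σ² (I - C(θ))⁻¹` of the field. -/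
def cov {p : ℕ} [NeZero p] (σ : ℝ) (θ : Param p) : Matrix (Lattice p) (Lattice p) ℝ :=
  σ ^ 2 • (1 - circ θ)⁻¹

/-- The distribution of `n` i.i.d. observations of the field `X ∼ 𝓝(0, Σ)`. -/
def dataLaw {p : ℕ} [NeZero p] (σ : ℝ) (θ : Param p) (n : ℕ) :
    Measure (Fin n → EuclideanSpace ℝ (Lattice p)) :=
  Measure.pi fun _ => multivariateGaussian 0 (cov σ θ)

/-- The loss `l(θ₁, θ₂)` when the field has parameters `σ` and `θ`. -/
def loss {p : ℕ} [NeZero p] (σ : ℝ) (θ θ₁ θ₂ : Param p) : ℝ :=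
  1 / (p : ℝ) ^ 2 *
    Matrix.trace ((circ θ₁ - circ θ₂) * cov σ θ * (circ θ₁ - circ θ₂))

/-- The conditional least squares criterion `γ_{n,p}(θ')` of the observations `X`. -/
def clsCriterion {p : ℕ} [NeZero p] {n : ℕ} (X : Fin n → EuclideanSpace ℝ (Lattice p))
    (θ' : Param p) : ℝ :=
  1 / ((n : ℝ) * (p : ℝ) ^ 2) *
    ∑ i, ∑ j, (X i j - ∑ l ∈ Finset.univ.erase (0 : Lattice p), θ' l * X i (j + l)) ^ 2

/-- A minimizer of `f` over `S`. -/
def argminOn {p : ℕ} (f : Param p → ℝ) (S : Set (Param p)) : Param p :=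
  Classical.epsilon fun θ => θ ∈ S ∧ ∀ θ' ∈ S, f θ ≤ f θ'

/-- The conditional least squares estimator: the minimizer of `γ_{n,p}` over the closure of
`Θ⁺_{m,ρ₁}`. -/
def clsEstimator {p : ℕ} [NeZero p] {n : ℕ} (m : Set (Lattice p)) (ρ₁ : ℝ)
    (X : Fin n → EuclideanSpace ℝ (Lattice p)) : Param p :=
  argminOn (clsCriterion X) (closure (ThetaModelPlusRho m ρ₁))

/-- The projection `θ_{m,ρ₁}`: the minimizer of `l(·, θ)` over the closure of `Θ⁺_{m,ρ₁}`. -/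
def proj {p : ℕ} [NeZero p] (σ : ℝ) (m : Set (Lattice p)) (ρ₁ : ℝ) (θ : Param p) : Param p :=
  argminOn (fun θ' => loss σ θ θ' θ) (closure (ThetaModelPlusRho m ρ₁))

/-- The risk `𝔼_θ[l(θ̂_{m,ρ₁}, θ₀)]` of the conditional least squares estimator based on `n`
observations, relative to the matrix `θ₀`. -/
def clsRisk {p : ℕ} [NeZero p] (σ : ℝ) (θ : Param p) (m : Set (Lattice p)) (ρ₁ : ℝ)
    (θ₀ : Param p) (n : ℕ) : ℝ :=
  ∫ X, loss σ θ (clsEstimator m ρ₁ X) θ₀ ∂(dataLaw σ θ n)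

end

end TorusGMRF

/-!
The torus is fixed and only the number `n` of observations grows, so the result is a classical
second-order expansion of an M-estimator, followed by a variance computation for Gaussian quadratic
forms. Write `P = I - C(θ)`, `Σ = σ² P⁻¹`, let `β` be the projection of `θ` on the model and
`Q = I - C(β)`.

*The projection is interior.* In the well-specified case `β = θ`. Under `‖θ‖₁ < 1` the point is that
`‖β‖₁ ≤ ‖θ‖₁` (`exists_projection_l1norm_le`), so that `I - C(β)` has its spectrum in `(0, 2)`. The
norm `‖β‖₁` is the value at the origin of a function `h = P⁻¹ v` that equals the sign of `β` on the
model and satisfies `P h = 0` off the model; the maximum principle for the weights `θ`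
(`abs_le_l1norm_of_harmonic`) bounds this value by `‖θ‖₁`.

*Expansion.* In coordinates orthonormal for the loss, the criterion around `β` is
`-2⟪G, u⟫ + ‖u‖² + b u u`, where `G` is the mean of centered i.i.d. scores and `b` a mean of
centered i.i.d. variables. The deterministic lemma `abs_norm_sq_argmin_sub_le` shows that the squared
norm of the minimizer over the bounded parameter set is `‖G‖²`, up to terms that fourth moments control
(`tendsto_integral_of_abs_sub_sum_sq_le`). Hence `n` times the risk tends to the sum of the
variances of the scores.

*Measurability.* Almost surely no discrete Fourier coefficient of the field vanishes
(`ae_convolution_injective`), so the criterion is strictly convex and its minimizer over a compact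
convex set is unique; the estimator is continuous in the data wherever it is unique
(`aestronglyMeasurable_comp_argmin`).

*Lower bound.* The score in the direction `v` is the quadratic form of `C(v) Q / p²`, and the
variance of `Xᵀ B X` is `κ tr(BΣBΣ)` with `κ` the variance of the square of a standard Gaussian
variable. All matrices here commute, so a comparison `σ² Q² ≥ c P` gives at least `κ c` for each of
the `d_m` directions (`mul_lossForm_le_trace`). If `β = θ` one may take `c = σ² φ_min(P)`; if
`‖θ‖₁ < 1` one may take `c = σ² (1 - ‖θ‖₁)² / 2`. The universal constant is `κ / 2`.
-/

namespace TorusGMRF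

/-! ### Minimizers of perturbed quadratics -/

section Perturbation

open scoped RealInnerProductSpace

variable {E : Type*} [NormedAddCommGroup E] [InnerProductSpace ℝ E]

/-- If `t ↦ t * x + t ^ 2 * y` is nonnegative near `0` then `x = 0`. -/
lemma eq_zero_of_linear_add_sq_nonneg {x y δ : ℝ} (hδ : 0 < δ)
    (h : ∀ t : ℝ, |t| ≤ δ → 0 ≤ t * x + t ^ 2 * y) : x = 0 := by
  by_contra hx
  have hx' : 0 < |x| := abs_pos.2 hx
  set t : ℝ := min δ (|x| / (2 * (|y| + 1))) with ht
  have hy : 0 < 2 * (|y| + 1) := by positivity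
  have ht0 : 0 < t := lt_min hδ (by positivity)
  have ht1 : t * (2 * (|y| + 1)) ≤ |x| := (le_div_iff₀ hy).1 (min_le_right _ _)
  have htδ : t ≤ δ := min_le_left _ _
  have key : 0 ≤ -(t * |x|) + t ^ 2 * |y| := by
    have hyy : t ^ 2 * y ≤ t ^ 2 * |y| := by gcongr; exact le_abs_self y
    rcases abs_cases x with ⟨h1, _⟩ | ⟨h1, _⟩
    · have := h (-t) (by rw [abs_neg, abs_of_pos ht0]; exact htδ)
      rw [h1]; nlinarith
    · have := h t (by rw [abs_of_pos ht0]; exact htδ)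
      rw [h1]; nlinarith
  nlinarith [abs_nonneg y]

/-- Stability of the minimizer of a perturbed quadratic: over a bounded set containing a ball
around `0`, the minimizer of `v ↦ -2⟪G, v⟫ + ‖v‖² + b v v` has squared norm `‖G‖²` up to terms of
higher order in `G` and in the size `h` of the perturbation `b`. When `h` and `‖G‖` are small the
minimizer is interior and solves `u + b u = G`; otherwise one of the fourth powers dominates
everything. -/
lemma abs_norm_sq_argmin_sub_le {K : Set E} {ε M : ℝ} (hε : 0 < ε)
    (hK : ∀ v : E, ‖v‖ ≤ ε → v ∈ K) (hM : ∀ v ∈ K, ‖v‖ ^ 2 ≤ M)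
    (b : LinearMap.BilinForm ℝ E) (hb : ∀ u v, b u v = b v u) {h : ℝ} (h0 : 0 ≤ h)
    (hbh : ∀ u v, |b u v| ≤ h * ‖u‖ * ‖v‖) (G u : E) (hu : u ∈ K)
    (hmin : ∀ v ∈ K, -2 * ⟪G, u⟫ + ‖u‖ ^ 2 + b u u ≤ -2 * ⟪G, v⟫ + ‖v‖ ^ 2 + b v v) :
    |‖u‖ ^ 2 - ‖G‖ ^ 2| ≤
      (20 + 16 * M + M * (8 / ε) ^ 4 + (8 / ε) ^ 2) * (h * ‖G‖ ^ 2 + h ^ 4 + ‖G‖ ^ 4) := by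
  have hM0 : 0 ≤ M := (sq_nonneg _).trans (hM u hu)
  have hG0 := norm_nonneg G
  have hu0 := norm_nonneg u
  have hS : 0 ≤ h * ‖G‖ ^ 2 + h ^ 4 + ‖G‖ ^ 4 := by positivity
  have hC1 : 0 ≤ M * (8 / ε) ^ 4 := by positivity
  have hC2 : 0 ≤ (8 / ε) ^ 2 := by positivity
  have p1 : 0 ≤ h * ‖G‖ ^ 2 := by positivity
  have p2 : 0 ≤ h ^ 4 := by positivity
  have p3 : 0 ≤ ‖G‖ ^ 4 := by positivity
  -- `G` is not small: `‖G‖ ^ 4` dominates both squares.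
  by_cases hG : ε / 8 ≤ ‖G‖
  · have e1 : 1 ≤ 8 / ε * ‖G‖ := by
      rw [div_mul_eq_mul_div, le_div_iff₀ hε]; linarith
    have e2 : 1 ≤ (8 / ε) ^ 4 * ‖G‖ ^ 4 := by rw [← mul_pow]; exact one_le_pow₀ e1
    have e3 : ‖G‖ ^ 2 ≤ (8 / ε) ^ 2 * ‖G‖ ^ 4 := by
      have : 1 ≤ (8 / ε * ‖G‖) ^ 2 := one_le_pow₀ e1
      nlinarith [sq_nonneg ‖G‖]
    have e4 : M ≤ M * (8 / ε) ^ 4 * ‖G‖ ^ 4 := by nlinarith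
    rw [abs_le]
    constructor <;> nlinarith [hM u hu, sq_nonneg ‖u‖, sq_nonneg ‖G‖, mul_nonneg hC1 p3,
      mul_nonneg hC2 p3, mul_nonneg hC1 p1, mul_nonneg hC1 p2, mul_nonneg hC2 p1,
      mul_nonneg hC2 p2, mul_nonneg hM0 p1, mul_nonneg hM0 p2, mul_nonneg hM0 p3]
  -- `h` is not small: `h ^ 4` dominates `‖u‖ ^ 2`, and `h * ‖G‖ ^ 2` dominates `‖G‖ ^ 2`.
  by_cases hh : 1 / 2 ≤ h
  · have e2 : 1 ≤ 16 * h ^ 4 := by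
      have : (1 / 2) ^ 4 ≤ h ^ 4 := by gcongr
      linarith
    have e4 : M ≤ 16 * M * h ^ 4 := by nlinarith
    have e3 : ‖G‖ ^ 2 ≤ 2 * (h * ‖G‖ ^ 2) := by nlinarith [sq_nonneg ‖G‖]
    rw [abs_le]
    constructor <;> nlinarith [hM u hu, sq_nonneg ‖u‖, sq_nonneg ‖G‖, mul_nonneg hC1 p3,
      mul_nonneg hC2 p3, mul_nonneg hC1 p1, mul_nonneg hC1 p2, mul_nonneg hC2 p1,
      mul_nonneg hC2 p2, mul_nonneg hM0 p1, mul_nonneg hM0 p2, mul_nonneg hM0 p3]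
  push Not at hG hh
  -- Comparison with `0` shows that `u` has norm at most `ε / 2`, hence is an interior point.
  have hub : ‖u‖ ≤ 4 * ‖G‖ := by
    have h1 := hmin 0 (hK 0 (by simpa using hε.le))
    simp only [inner_zero_right, norm_zero, map_zero] at h1
    have h2 : ⟪G, u⟫ ≤ ‖G‖ * ‖u‖ := real_inner_le_norm G u
    have h3 := (abs_le.1 (hbh u u)).1
    by_contra hlt
    push Not at hlt
    nlinarith [mul_pos (hG0.trans_lt (by linarith : ‖G‖ < ‖u‖)) (sub_pos.2 hlt)]
  -- The first-order condition at an interior minimizer.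
  have hfoc : ∀ w : E, ⟪u, w⟫ + b u w - ⟪G, w⟫ = 0 := by
    intro w
    have hδ : 0 < ε / (2 * (‖w‖ + 1)) := by positivity
    have := eq_zero_of_linear_add_sq_nonneg (x := 2 * (⟪u, w⟫ + b u w - ⟪G, w⟫))
      (y := ‖w‖ ^ 2 + b w w) hδ ?_
    · linarith
    intro t ht
    have hmem : u + t • w ∈ K := by
      apply hK
      refine (norm_add_le _ _).trans ?_
      rw [norm_smul, Real.norm_eq_abs]
      have : |t| * ‖w‖ ≤ ε / 2 := by
        rw [le_div_iff₀ (by positivity)] at ht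
        nlinarith [abs_nonneg t, norm_nonneg w]
      linarith
    have h1 := hmin _ hmem
    rw [norm_add_sq_real, inner_add_right, real_inner_smul_right, real_inner_smul_right,
      norm_smul, mul_pow, Real.norm_eq_abs, sq_abs] at h1
    simp only [map_add, map_smul, LinearMap.add_apply, LinearMap.smul_apply, smul_eq_mul] at h1
    rw [hb w u] at h1
    nlinarith
  have hdist : ‖u - G‖ ≤ h * ‖u‖ := by
    have h1 := hfoc (u - G)
    have h2 : ⟪u, u - G⟫ - ⟪G, u - G⟫ = ‖u - G‖ ^ 2 := by
      rw [← inner_sub_left, real_inner_self_eq_norm_sq]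
    have h3 := (abs_le.1 (hbh u (u - G))).1
    by_contra hlt
    push Not at hlt
    nlinarith [mul_pos ((mul_nonneg h0 hu0).trans_lt hlt) (sub_pos.2 hlt)]
  have h4 : |‖u‖ - ‖G‖| ≤ 4 * h * ‖G‖ := by
    refine (abs_norm_sub_norm_le u G).trans (hdist.trans ?_)
    nlinarith
  have h5 : |‖u‖ ^ 2 - ‖G‖ ^ 2| ≤ 20 * (h * ‖G‖ ^ 2) := by
    rw [sq_sub_sq, abs_mul, abs_of_nonneg (by positivity : 0 ≤ ‖u‖ + ‖G‖)]
    calc (‖u‖ + ‖G‖) * |‖u‖ - ‖G‖| ≤ (5 * ‖G‖) * (4 * h * ‖G‖) := by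
          gcongr; linarith
      _ = _ := by ring
  refine h5.trans ?_
  nlinarith [mul_nonneg hC1 hS, mul_nonneg hC2 hS, mul_nonneg hM0 hS]

end Perturbation

/-! ### Moments of sample means -/

section Moments

variable {Ω : Type*} {mΩ : MeasurableSpace Ω}

lemma integrable_pow_of_memLp_four {μ : Measure Ω} [IsFiniteMeasure μ] {f : Ω → ℝ}
    (hf : MemLp f 4 μ) {k : ℕ} (hk : k ≤ 4) : Integrable (fun x => f x ^ k) μ := by
  have h : MemLp f (k : ENNReal) μ := hf.mono_exponent (by exact_mod_cast hk)
  have := h.integrable_norm_pow'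
  refine (integrable_norm_iff (hf.1.pow k)).1 ?_
  simpa [norm_pow] using this

/-- First, second and fourth moments of a sum of independent centered variables with common
moments. -/
lemma moments_sum_of_iIndepFun {μ : Measure Ω} [IsProbabilityMeasure μ] {ι : Type*} [DecidableEq ι]
    {Z : ι → Ω → ℝ} (hZ : ∀ i, MemLp (Z i) 4 μ) (hm : ∀ i, Measurable (Z i))
    (hind : iIndepFun Z μ) {v κ : ℝ} (h1 : ∀ i, ∫ x, Z i x ∂μ = 0)
    (h2 : ∀ i, ∫ x, Z i x ^ 2 ∂μ = v) (h4 : ∀ i, ∫ x, Z i x ^ 4 ∂μ ≤ κ) (hv : v ^ 2 ≤ κ)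
    (s : Finset ι) :
    ∫ x, (∑ i ∈ s, Z i x) ∂μ = 0 ∧ ∫ x, (∑ i ∈ s, Z i x) ^ 2 ∂μ = s.card * v ∧
      ∫ x, (∑ i ∈ s, Z i x) ^ 4 ∂μ ≤ 3 * (s.card : ℝ) ^ 2 * κ := by
  induction s using Finset.induction_on with
  | empty => simp
  | insert a s ha ih =>
    obtain ⟨i1, i2, i4⟩ := ih
    have hS : MemLp (fun x => ∑ i ∈ s, Z i x) 4 μ := memLp_finsetSum _ fun i _ => hZ i
    have hI : IndepFun (fun x => ∑ i ∈ s, Z i x) (Z a) μ := by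
      have := hind.indepFun_finsetSum_of_notMem hm ha
      convert this using 1
      ext x; simp
    have hprod : ∀ j k : ℕ, ∫ x, (∑ i ∈ s, Z i x) ^ j * Z a x ^ k ∂μ =
        (∫ x, (∑ i ∈ s, Z i x) ^ j ∂μ) * ∫ x, Z a x ^ k ∂μ := fun j k =>
      (hI.comp (measurable_id.pow_const j)
        (measurable_id.pow_const k)).integral_fun_mul_eq_mul_integral
          (hS.1.pow j) ((hZ a).1.pow k)
    have hint : ∀ j k : ℕ, j ≤ 4 → k ≤ 4 →
        Integrable (fun x => (∑ i ∈ s, Z i x) ^ j * Z a x ^ k) μ := fun j k hj hk =>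
      (hI.comp (measurable_id.pow_const j) (measurable_id.pow_const k)).integrable_mul
        (integrable_pow_of_memLp_four hS hj) (integrable_pow_of_memLp_four (hZ a) hk)
    have hSi := fun {k : ℕ} (hk : k ≤ 4) => integrable_pow_of_memLp_four hS hk
    have hZi := fun {k : ℕ} (hk : k ≤ 4) => integrable_pow_of_memLp_four (hZ a) hk
    simp only [Finset.sum_insert ha, Finset.card_insert_of_notMem ha]
    have hS1 : Integrable (fun x => ∑ i ∈ s, Z i x) μ := by simpa using hSi (k := 1) (by norm_num)
    have hZ1 : Integrable (Z a) μ := by simpa using hZi (k := 1) (by norm_num)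
    -- The terms of odd degree in one of the factors vanish because `Z a` and the sum are centered.
    have p11 := hprod 1 1
    have p31 := hprod 3 1
    have p22 := hprod 2 2
    have p13 := hprod 1 3
    simp only [pow_one, h1, i1, mul_zero, zero_mul, i2, h2] at p11 p31 p22 p13
    refine ⟨?_, ?_, ?_⟩
    · rw [integral_add hZ1 hS1, h1, i1, add_zero]
    · have e : ∀ x, (Z a x + ∑ i ∈ s, Z i x) ^ 2 =
          (∑ i ∈ s, Z i x) ^ 2 + 2 * ((∑ i ∈ s, Z i x) * Z a x) + Z a x ^ 2 := fun x => by ring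
      simp_rw [e]
      have j11 := hint 1 1 (by norm_num) (by norm_num)
      simp only [pow_one] at j11
      have a1 := (hSi (k := 2) (by norm_num)).add (j11.const_mul 2)
      simp only [Pi.add_def] at a1
      rw [integral_add a1 (hZi (by norm_num)),
        integral_add (hSi (by norm_num)) (j11.const_mul 2), integral_const_mul, p11, i2, h2]
      push_cast; ring
    · have e : ∀ x, (Z a x + ∑ i ∈ s, Z i x) ^ 4 =
          (∑ i ∈ s, Z i x) ^ 4 + 4 * ((∑ i ∈ s, Z i x) ^ 3 * Z a x) +
            6 * ((∑ i ∈ s, Z i x) ^ 2 * Z a x ^ 2) + 4 * ((∑ i ∈ s, Z i x) * Z a x ^ 3) +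
            Z a x ^ 4 := fun x => by ring
      simp_rw [e]
      have j31 := hint 3 1 (by norm_num) (by norm_num)
      have j22 := hint 2 2 (by norm_num) (by norm_num)
      have j13 := hint 1 3 (by norm_num) (by norm_num)
      simp only [pow_one] at j31 j13
      have a1 := (hSi (k := 4) le_rfl).add (j31.const_mul 4)
      have a2 := a1.add (j22.const_mul 6)
      have a3 := a2.add (j13.const_mul 4)
      simp only [Pi.add_def] at a1 a2 a3
      rw [integral_add a3 (hZi le_rfl), integral_add a2 (j13.const_mul 4),
        integral_add a1 (j22.const_mul 6), integral_add (hSi le_rfl) (j31.const_mul 4),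
        integral_const_mul, integral_const_mul, integral_const_mul, p31, p22, p13]
      have := h4 a
      push_cast
      have hk : (0 : ℝ) ≤ s.card := Nat.cast_nonneg _
      nlinarith

/-- The empirical mean of `f` over the sample `X`. -/
noncomputable def sampleMean {n : ℕ} (f : Ω → ℝ) (X : Fin n → Ω) : ℝ := (∑ i, f (X i)) / n

variable (P : Measure Ω) [IsProbabilityMeasure P] {n : ℕ}

lemma memLp_comp_eval {f : Ω → ℝ} (hf : MemLp f 4 P) (i : Fin n) :
    MemLp (fun X : Fin n → Ω => f (X i)) 4 (Measure.pi fun _ => P) :=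
  hf.comp_measurePreserving (measurePreserving_eval (fun _ : Fin n => P) i)

lemma memLp_sampleMean {f : Ω → ℝ} (hf : MemLp f 4 P) :
    MemLp (sampleMean f : (Fin n → Ω) → ℝ) 4 (Measure.pi fun _ => P) := by
  have h : MemLp (fun X : Fin n → Ω => ∑ i, f (X i)) 4 (Measure.pi fun _ => P) :=
    memLp_finsetSum _ fun i _ => memLp_comp_eval P hf i
  exact (memLp_congr_ae (ae_of_all _ fun X => by simp [sampleMean, div_eq_mul_inv])).1
    (h.mul_const (n : ℝ)⁻¹)

lemma moments_sampleMean {f : Ω → ℝ} (hfm : Measurable f) (hf : MemLp f 4 P)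
    (h0 : ∫ x, f x ∂P = 0) (hn : 1 ≤ n) :
    n * ∫ X, (sampleMean f X : ℝ) ^ 2 ∂(Measure.pi fun _ : Fin n => P) = ∫ x, f x ^ 2 ∂P ∧
    ∫ X, (sampleMean f X : ℝ) ^ 4 ∂(Measure.pi fun _ : Fin n => P) ≤
      3 * (∫ x, f x ^ 4 ∂P + (∫ x, f x ^ 2 ∂P) ^ 2) / (n : ℝ) ^ 2 := by
  have hn' : (0 : ℝ) < n := by exact_mod_cast hn
  have h4 : 0 ≤ ∫ x, f x ^ 4 ∂P := integral_nonneg fun x => by positivity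
  obtain ⟨-, h2, h4⟩ := moments_sum_of_iIndepFun (μ := Measure.pi fun _ : Fin n => P)
    (Z := fun i X => f (X i)) (v := ∫ x, f x ^ 2 ∂P)
    (κ := ∫ x, f x ^ 4 ∂P + (∫ x, f x ^ 2 ∂P) ^ 2)
    (fun i => memLp_comp_eval P hf i) (fun i => hfm.comp (measurable_pi_apply i))
    (iIndepFun_pi fun _ => hfm.aemeasurable)
    (fun i => (integral_comp_eval (μ := fun _ : Fin n => P) hfm.aestronglyMeasurable).trans h0)
    (fun i => integral_comp_eval (μ := fun _ : Fin n => P)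
      (hfm.pow_const 2).aestronglyMeasurable)
    (fun i => (integral_comp_eval (μ := fun _ : Fin n => P)
      (hfm.pow_const 4).aestronglyMeasurable).trans_le (by nlinarith))
    (by linarith) Finset.univ
  simp only [Finset.card_univ, Fintype.card_fin] at h2 h4
  simp only [sampleMean, div_pow, integral_div]
  constructor
  · rw [h2]; field_simp
  · rw [div_le_div_iff₀ (by positivity) (by positivity)]
    calc _ ≤ (3 * (n : ℝ) ^ 2 * (∫ x, f x ^ 4 ∂P + (∫ x, f x ^ 2 ∂P) ^ 2)) * (n : ℝ) ^ 2 := by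
          gcongr
      _ = _ := by ring

lemma integrable_sum_sq_sampleMean_sq {ι : Type*} [Fintype ι] {g : ι → Ω → ℝ}
    (hg : ∀ j, MemLp (g j) 4 P) :
    Integrable (fun X : Fin n → Ω => (∑ j, sampleMean (g j) X ^ 2) ^ 2)
      (Measure.pi fun _ : Fin n => P) := by
  have h : MemLp (fun X : Fin n → Ω => ∑ j, sampleMean (g j) X ^ 2) 2
      (Measure.pi fun _ : Fin n => P) := by
    refine memLp_finsetSum _ fun j _ => ?_
    have h4 := memLp_sampleMean P (n := n) (hg j)
    refine (memLp_two_iff_integrable_sq (h4.1.pow 2)).2 ?_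
    simpa [← pow_mul] using integrable_pow_of_memLp_four h4 le_rfl
  exact h.integrable_sq

lemma integral_sum_sq_sampleMean_sq_le {ι : Type*} [Fintype ι] {g : ι → Ω → ℝ}
    (hgm : ∀ j, Measurable (g j)) (hg : ∀ j, MemLp (g j) 4 P) (hg0 : ∀ j, ∫ x, g j x ∂P = 0) :
    ∃ A : ℝ, 0 ≤ A ∧ ∀ n : ℕ, 1 ≤ n →
      ∫ X, (∑ j, sampleMean (g j) X ^ 2) ^ 2 ∂(Measure.pi fun _ : Fin n => P)
        ≤ A / (n : ℝ) ^ 2 := by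
  set κ : ι → ℝ := fun j => 3 * (∫ x, g j x ^ 4 ∂P + (∫ x, g j x ^ 2 ∂P) ^ 2) with hκ
  have hκ0 : ∀ j, 0 ≤ κ j := fun j => by
    have : 0 ≤ ∫ x, g j x ^ 4 ∂P := integral_nonneg fun x => by positivity
    positivity
  refine ⟨Fintype.card ι * ∑ j, κ j,
    mul_nonneg (Nat.cast_nonneg _) (Finset.sum_nonneg fun j _ => hκ0 j), fun n hn => ?_⟩
  have hi : ∀ j, Integrable (fun X : Fin n → Ω => sampleMean (g j) X ^ 4)
      (Measure.pi fun _ : Fin n => P) := fun j =>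
    integrable_pow_of_memLp_four (memLp_sampleMean P (hg j)) le_rfl
  calc ∫ X, (∑ j, sampleMean (g j) X ^ 2) ^ 2 ∂(Measure.pi fun _ : Fin n => P)
      ≤ ∫ X, Fintype.card ι * ∑ j, sampleMean (g j) X ^ 4 ∂(Measure.pi fun _ : Fin n => P) := by
        refine integral_mono (integrable_sum_sq_sampleMean_sq P hg)
          ((integrable_finsetSum _ fun j _ => hi j).const_mul _) fun X => ?_
        have := sq_sum_le_card_mul_sum_sq (s := Finset.univ)
          (f := fun j => sampleMean (g j) X ^ 2)
        simpa [← pow_mul] using this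
    _ = Fintype.card ι * ∑ j, ∫ X, sampleMean (g j) X ^ 4 ∂(Measure.pi fun _ : Fin n => P) := by
        rw [integral_const_mul, integral_finsetSum _ fun j _ => hi j]
    _ ≤ Fintype.card ι * ∑ j, κ j / (n : ℝ) ^ 2 := by
        gcongr with j
        exact (moments_sampleMean P (hgm j) (hg j) (hg0 j) hn).2
    _ = _ := by rw [← Finset.sum_div]; ring

/-- Second-order asymptotics of a statistic `T n` of an i.i.d. sample that agrees with the squared
norm of the mean of a centered vector `g`, up to terms of higher order in that mean and in the mean
of further centered variables `a`: then `n 𝔼[T n]` tends to `∑ j, 𝔼[g j ^ 2]`. -/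
lemma tendsto_integral_of_abs_sub_sum_sq_le {ι κ : Type*} [Fintype ι] [Fintype κ]
    {g : ι → Ω → ℝ} {a : κ → Ω → ℝ} (hgm : ∀ j, Measurable (g j)) (ham : ∀ j, Measurable (a j))
    (hg : ∀ j, MemLp (g j) 4 P) (ha : ∀ j, MemLp (a j) 4 P)
    (hg0 : ∀ j, ∫ x, g j x ∂P = 0) (ha0 : ∀ j, ∫ x, a j x ∂P = 0)
    (T : (n : ℕ) → (Fin n → Ω) → ℝ)
    (hT : ∀ n : ℕ, 1 ≤ n → Integrable (T n) (Measure.pi fun _ => P)) {C : ℝ} (hC : 0 ≤ C)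
    (hbound : ∀ n : ℕ, 1 ≤ n → ∀ᵐ X ∂(Measure.pi fun _ : Fin n => P),
      |T n X - ∑ j, sampleMean (g j) X ^ 2| ≤
        C * (√(∑ j, sampleMean (a j) X ^ 2) * ∑ j, sampleMean (g j) X ^ 2 +
          (∑ j, sampleMean (a j) X ^ 2) ^ 2 + (∑ j, sampleMean (g j) X ^ 2) ^ 2)) :
    Tendsto (fun n : ℕ => n * ∫ X, T n X ∂(Measure.pi fun _ : Fin n => P)) atTop
      (𝓝 (∑ j, ∫ x, g j x ^ 2 ∂P)) := by
  obtain ⟨A, hA0, hA⟩ := integral_sum_sq_sampleMean_sq_le P hgm hg hg0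
  obtain ⟨B, hB0, hB⟩ := integral_sum_sq_sampleMean_sq_le P ham ha ha0
  set R := ∑ j, ∫ x, g j x ^ 2 ∂P with hR
  have hlim : Tendsto (fun n : ℕ => C * (3 * A + 3 * B + 1) / √(n : ℝ)) atTop (𝓝 0) :=
    (Real.tendsto_sqrt_atTop.comp tendsto_natCast_atTop_atTop).const_div_atTop _
  refine tendsto_iff_dist_tendsto_zero.2 (squeeze_zero' (Eventually.of_forall fun n => dist_nonneg)
    ?_ hlim)
  filter_upwards [eventually_ge_atTop 1] with n hn
  have hn1 : (1 : ℝ) ≤ n := by exact_mod_cast hn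
  have hn0 : (0 : ℝ) < n := by linarith
  set s := √(n : ℝ) with hs
  have hs1 : 1 ≤ s := Real.one_le_sqrt.2 hn1
  have hs0 : 0 < s := by linarith
  have hss : s * s = n := Real.mul_self_sqrt hn0.le
  set μ := (Measure.pi fun _ : Fin n => P) with hμ
  have hSi : Integrable (fun X : Fin n → Ω => ∑ j, sampleMean (g j) X ^ 2) μ :=
    integrable_finsetSum _ fun j _ =>
      integrable_pow_of_memLp_four (memLp_sampleMean P (hg j)) (by norm_num)
  have hS2i := integrable_sum_sq_sampleMean_sq P (n := n) hg
  have hN2i := integrable_sum_sq_sampleMean_sq P (n := n) ha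
  have hSR : n * ∫ X, (∑ j, sampleMean (g j) X ^ 2) ∂μ = R := by
    rw [integral_finsetSum _ fun j _ =>
      integrable_pow_of_memLp_four (memLp_sampleMean P (hg j)) (by norm_num), Finset.mul_sum]
    exact Finset.sum_congr rfl fun j _ => (moments_sampleMean P (hgm j) (hg j) (hg0 j) hn).1
  -- Young's inequality, with weights `√n` and `n`, separates the mixed term.
  have hptw : ∀ᵐ X ∂μ, ‖T n X - ∑ j, sampleMean (g j) X ^ 2‖ ≤
      C * (2 * s * (∑ j, sampleMean (g j) X ^ 2) ^ 2 +
        2 * s * (∑ j, sampleMean (a j) X ^ 2) ^ 2 + 1 / (n * s)) := by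
    filter_upwards [hbound n hn] with X hX
    rw [Real.norm_eq_abs]
    refine hX.trans ?_
    gcongr ?_ * ?_
    set S := ∑ j, sampleMean (g j) X ^ 2
    set N := ∑ j, sampleMean (a j) X ^ 2
    have hN0 : 0 ≤ N := Finset.sum_nonneg fun j _ => sq_nonneg _
    have hr : √N * √N = N := Real.mul_self_sqrt hN0
    have y1 : √N * S ≤ (s * S ^ 2 + N / s) / 2 := by
      have := sq_nonneg (s * S - √N)
      have h2 : s * S ^ 2 + N / s - 2 * (√N * S) = (s * S - √N) ^ 2 / s := by
        field_simp; nlinarith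
      have h3 : 0 ≤ (s * S - √N) ^ 2 / s := by positivity
      linarith
    have y2 : N / s ≤ (s * N ^ 2 + 1 / (n * s)) / 2 := by
      have h2 : s * N ^ 2 + 1 / (n * s) - 2 * (N / s) = (n * N - 1) ^ 2 / (n * s) := by
        rw [← hss]; field_simp; ring
      have h3 : 0 ≤ (n * N - 1) ^ 2 / (n * s) := by positivity
      linarith
    have y3 : 0 ≤ 1 / (n * s) := by positivity
    nlinarith [sq_nonneg S, sq_nonneg N, mul_nonneg (sub_nonneg.2 hs1) (sq_nonneg S),
      mul_nonneg (sub_nonneg.2 hs1) (sq_nonneg N)]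
  rw [Real.dist_eq, ← hSR, ← mul_sub, abs_mul, abs_of_pos hn0, ← integral_sub (hT n hn) hSi]
  have i1 := hS2i.const_mul (2 * s)
  have i2 := hN2i.const_mul (2 * s)
  have i12 := i1.add i2
  simp only [Pi.add_def] at i12
  have hle := norm_integral_le_of_norm_le
    ((i12.add (integrable_const (1 / (n * s)))).const_mul C) hptw
  rw [integral_const_mul, Real.norm_eq_abs] at hle
  simp only [Pi.add_apply] at hle
  rw [integral_add i12 (integrable_const _), integral_add i1 i2, integral_const_mul,
    integral_const_mul, integral_const, probReal_univ, one_smul] at hle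
  calc (n : ℝ) * |∫ X, (T n X - ∑ j, sampleMean (g j) X ^ 2) ∂μ|
      ≤ n * (C * (2 * s * (A / (n : ℝ) ^ 2) + 2 * s * (B / (n : ℝ) ^ 2) + 1 / (n * s))) := by
        refine mul_le_mul_of_nonneg_left (hle.trans ?_) hn0.le
        gcongr
        · exact hA n hn
        · exact hB n hn
    _ = C * (2 * A + 2 * B + 1) / s := by
        rw [← hss]; field_simp
    _ ≤ C * (3 * A + 3 * B + 1) / s := by gcongr <;> norm_num

end Moments

/-! ### Quadratic forms and convolutions of Gaussian vectors -/

section GaussianQuadraticForms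

open Matrix
open scoped RealInnerProductSpace MatrixOrder

variable {ι : Type*} [Fintype ι]

lemma measurable_quadraticForm (B : Matrix ι ι ℝ) :
    Measurable fun x : EuclideanSpace ℝ ι => x.ofLp ⬝ᵥ B *ᵥ x.ofLp := by
  simp only [dotProduct, mulVec]
  fun_prop

variable [DecidableEq ι]

lemma trace_mul_self_eq_sum_eigenvalues {A : Matrix ι ι ℝ} (hA : A.IsHermitian) :
    (A * A).trace = ∑ i, hA.eigenvalues i ^ 2 := by
  have h : A * A = Unitary.conjStarAlgAut ℝ _ hA.eigenvectorUnitary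
      (diagonal (RCLike.ofReal ∘ hA.eigenvalues) * diagonal (RCLike.ofReal ∘ hA.eigenvalues)) := by
    rw [map_mul, ← hA.spectral_theorem]
  rw [h, Unitary.conjStarAlgAut_apply, trace_mul_comm, ← Matrix.mul_assoc,
    Unitary.coe_star_mul_self, Matrix.one_mul, diagonal_mul_diagonal,
    trace_diagonal]
  simp [sq]

/-- A quadratic form in a centered Gaussian vector is distributed as a linear combination of
squares of independent standard Gaussian variables; the coefficients are the eigenvalues of
`√S * B * √S`. -/
lemma exists_map_quadraticForm_multivariateGaussian {S B : Matrix ι ι ℝ} (hS : S.PosSemidef)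
    (hB : B.IsHermitian) :
    ∃ d : ι → ℝ, ∑ i, d i = (B * S).trace ∧ ∑ i, d i ^ 2 = (B * S * (B * S)).trace ∧
      (multivariateGaussian 0 S).map (fun x => x.ofLp ⬝ᵥ B *ᵥ x.ofLp) =
        (Measure.pi fun _ : ι => gaussianReal 0 1).map (fun y => ∑ i, d i * y i ^ 2) := by
  set T := CFC.sqrt S with hT
  have hTT : T * T = S := CFC.sqrt_mul_sqrt_self _ hS.nonneg
  have hTh : T.IsHermitian := (CFC.sqrt_nonneg S).isSelfAdjoint
  have hA : (T * B * T).IsHermitian := by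
    have := isHermitian_mul_mul_conjTranspose T hB
    rwa [hTh.eq] at this
  have hTt : Tᵀ = T := by simpa using hTh.eq
  refine ⟨hA.eigenvalues, ?_, ?_, ?_⟩
  · have := hA.trace_eq_sum_eigenvalues
    simp only [RCLike.ofReal_real_eq_id, id] at this
    rw [← this, Matrix.mul_assoc, trace_mul_comm, Matrix.mul_assoc, hTT]
  · rw [← trace_mul_self_eq_sum_eigenvalues, ← hTT]
    simp only [Matrix.mul_assoc]
    rw [trace_mul_comm]
    simp only [Matrix.mul_assoc]
  · rw [multivariateGaussian, stdGaussian_eq_map_pi_orthonormalBasis hA.eigenvectorBasis,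
      Measure.map_map (measurable_quadraticForm B) (by fun_prop),
      Measure.map_map ((measurable_quadraticForm B).comp (by fun_prop)) (by fun_prop)]
    congr 1
    ext y
    simp only [Function.comp_apply, zero_add, ofLp_toEuclideanCLM]
    set b := hA.eigenvectorBasis
    set x := ∑ i, y i • b i with hx
    have h1 : (T *ᵥ x.ofLp) ⬝ᵥ B *ᵥ (T *ᵥ x.ofLp) = x.ofLp ⬝ᵥ (T * B * T) *ᵥ x.ofLp := by
      rw [← mulVec_mulVec, ← mulVec_mulVec, dotProduct_mulVec x.ofLp, ← mulVec_transpose, hTt]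
    have h2 : (T * B * T) *ᵥ x.ofLp = (∑ i, (hA.eigenvalues i * y i) • b i).ofLp := by
      simp only [hx, WithLp.ofLp_sum, WithLp.ofLp_smul, mulVec_sum, mulVec_smul, b,
        hA.mulVec_eigenvectorBasis, smul_smul]
      simp [mul_comm]
    rw [← hT, h1, h2]
    have h3 : ∀ u v : EuclideanSpace ℝ ι, u.ofLp ⬝ᵥ v.ofLp = ⟪u, v⟫ := fun u v => by
      simp [PiLp.inner_apply, dotProduct, mul_comm]
    rw [h3, hx, b.orthonormal.inner_sum]
    refine Finset.sum_congr rfl fun i _ => ?_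
    simp; ring

/-- The variance of the square of a standard Gaussian variable. -/
noncomputable def varSqGaussian : ℝ := Var[fun x => x ^ 2; gaussianReal 0 1]

lemma memLp_sq_gaussianReal : MemLp (fun x : ℝ => x ^ 2) 2 (gaussianReal 0 1) := by
  refine (memLp_two_iff_integrable_sq (by fun_prop)).2 ?_
  have := integrable_pow_of_memLp_four (memLp_id_gaussianReal' (μ := 0) (v := 1) 4 (by simp))
    (k := 4) le_rfl
  simpa [← pow_mul] using this

lemma integral_sq_gaussianReal : ∫ x, x ^ 2 ∂(gaussianReal 0 1) = 1 := by
  have h := variance_eq_sub (memLp_id_gaussianReal' (μ := 0) (v := 1) 2 (by simp))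
  rw [variance_id_gaussianReal] at h
  simpa using h.symm

lemma varSqGaussian_pos : 0 < varSqGaussian := by
  refine (variance_nonneg _ _).lt_of_ne' fun h => ?_
  have h0 := ae_eq_integral_of_variance_eq_zero memLp_sq_gaussianReal h
  rw [integral_sq_gaussianReal] at h0
  have : NullSingletonClass (gaussianReal 0 1) := nullSingletonClass_gaussianReal one_ne_zero
  have h1 : ∀ᵐ x ∂(gaussianReal 0 1), x ∉ ({1, -1} : Set ℝ) :=
    measure_eq_zero_iff_ae_notMem.1 (Set.Countable.measure_zero (by simp) _)
  obtain ⟨x, hx, hx'⟩ := (h0.and h1).exists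
  exact hx' (by simpa using sq_eq_one_iff.1 hx)

lemma integral_quadraticForm_multivariateGaussian {S B : Matrix ι ι ℝ} (hS : S.PosSemidef)
    (hB : B.IsHermitian) :
    ∫ x, x.ofLp ⬝ᵥ B *ᵥ x.ofLp ∂(multivariateGaussian 0 S) = (B * S).trace := by
  obtain ⟨d, h1, -, h⟩ := exists_map_quadraticForm_multivariateGaussian hS hB
  have e : ∫ x, x.ofLp ⬝ᵥ B *ᵥ x.ofLp ∂(multivariateGaussian 0 S) =
      ∫ z, z ∂((multivariateGaussian 0 S).map (fun x => x.ofLp ⬝ᵥ B *ᵥ x.ofLp)) :=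
    (integral_map (measurable_quadraticForm B).aemeasurable aestronglyMeasurable_id).symm
  have hi : Integrable (fun x : ℝ => x ^ 2) (gaussianReal 0 1) :=
    memLp_sq_gaussianReal.integrable (by norm_num)
  rw [e, h, integral_map (f := fun z : ℝ => z) (Measurable.aemeasurable (by fun_prop))
    aestronglyMeasurable_id, integral_finsetSum, ← h1]
  · refine Finset.sum_congr rfl fun i _ => ?_
    rw [integral_const_mul, integral_comp_eval (μ := fun _ : ι => gaussianReal 0 1) (i := i)
      (f := fun x : ℝ => x ^ 2) (by fun_prop), integral_sq_gaussianReal, mul_one]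
  · exact fun i _ => (integrable_comp_eval (μ := fun _ : ι => gaussianReal 0 1) hi).const_mul _

lemma variance_quadraticForm_multivariateGaussian {S B : Matrix ι ι ℝ} (hS : S.PosSemidef)
    (hB : B.IsHermitian) :
    Var[fun x => x.ofLp ⬝ᵥ B *ᵥ x.ofLp; multivariateGaussian 0 S] =
      varSqGaussian * (B * S * (B * S)).trace := by
  obtain ⟨d, -, h2, h⟩ := exists_map_quadraticForm_multivariateGaussian hS hB
  have e : Var[fun x => x.ofLp ⬝ᵥ B *ᵥ x.ofLp; multivariateGaussian 0 S] =
      Var[id; (multivariateGaussian 0 S).map (fun x => x.ofLp ⬝ᵥ B *ᵥ x.ofLp)] :=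
    (variance_map aemeasurable_id (measurable_quadraticForm B).aemeasurable).symm
  rw [e, h, variance_map aemeasurable_id (Measurable.aemeasurable (by fun_prop)), ← h2]
  have h3 : (id ∘ fun y : ι → ℝ => ∑ i, d i * y i ^ 2) =
      ∑ i, fun y : ι → ℝ => (fun z : ℝ => d i * z ^ 2) (y i) := by ext y; simp
  rw [h3, variance_sum_pi (fun i => memLp_sq_gaussianReal.const_mul (d i)), Finset.mul_sum]
  refine Finset.sum_congr rfl fun i _ => ?_
  rw [variance_const_mul, varSqGaussian, mul_comm]

lemma memLp_quadraticForm_multivariateGaussian {S : Matrix ι ι ℝ} (B : Matrix ι ι ℝ) :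
    MemLp (fun x => x.ofLp ⬝ᵥ B *ᵥ x.ofLp) 4 (multivariateGaussian 0 S) := by
  have hc : ∀ i, MemLp (fun x : EuclideanSpace ℝ ι => x i) 8 (multivariateGaussian 0 S) :=
    fun i => IsGaussian.memLp_dual _ (EuclideanSpace.proj i) 8 (by simp)
  have : ENNReal.HolderTriple 8 8 4 := ⟨by
    rw [← two_mul, show (8 : ENNReal) = 2 * 4 by norm_num, ENNReal.mul_inv (by simp) (by simp),
      ← mul_assoc, ENNReal.mul_inv_cancel (by simp) (by simp), one_mul]⟩
  simp only [dotProduct, mulVec, Finset.mul_sum]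
  refine memLp_finsetSum _ fun i _ => memLp_finsetSum _ fun j _ => ?_
  have h := ((hc j).mul (hc i) (r := 4)).const_mul (B i j)
  refine (memLp_congr_ae (ae_of_all _ fun x => ?_)).1 h
  simp; ring

lemma ae_sum_mul_ne_zero_multivariateGaussian {S : Matrix ι ι ℝ} (hS : S.PosDef) {w : ι → ℝ}
    (hw : w ≠ 0) : ∀ᵐ x ∂(multivariateGaussian 0 S), ∑ i, x.ofLp i * w i ≠ 0 := by
  set ℓ : StrongDual ℝ (EuclideanSpace ℝ ι) := innerSL ℝ (WithLp.toLp 2 w) with hℓ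
  have hℓx : ∀ x, ℓ x = ∑ i, x.ofLp i * w i := fun x => by
    simp [hℓ, PiLp.inner_apply]
  have hvar : 0 < Var[ℓ; multivariateGaussian 0 S] := by
    have h := covarianceBilin_self (μ := multivariateGaussian 0 S) IsGaussian.memLp_two_id
      (WithLp.toLp 2 w)
    rw [covarianceBilin_multivariateGaussian hS.posSemidef] at h
    have h2 := hS.dotProduct_mulVec_pos hw
    rw [star_trivial] at h2
    have h3 : (fun u => ⟪WithLp.toLp 2 w, u⟫) = ⇑ℓ := by ext; simp [hℓ]
    rw [h3] at h
    rw [← h]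
    exact h2
  have hmap := IsGaussian.map_eq_gaussianReal (μ := multivariateGaussian 0 S) ℓ
  have hne : (Var[ℓ; multivariateGaussian 0 S]).toNNReal ≠ 0 := by simpa using hvar
  have : NullSingletonClass ((multivariateGaussian 0 S).map ℓ) := by
    rw [hmap]; exact nullSingletonClass_gaussianReal hne
  have h0 : ((multivariateGaussian 0 S).map ℓ) {0} = 0 := measure_singleton 0
  rw [Measure.map_apply (by fun_prop) (measurableSet_singleton 0)] at h0
  filter_upwards [measure_eq_zero_iff_ae_notMem.1 h0] with x hx
  rw [← hℓx]
  simpa using hx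

/-- Almost surely no discrete Fourier coefficient of a nondegenerate Gaussian field on a finite
abelian group vanishes, so that convolution with the field is injective. -/
lemma ae_convolution_injective {α : Type*} [AddCommGroup α] [Fintype α] [DecidableEq α]
    {S : Matrix α α ℝ} (hS : S.PosDef) :
    ∀ᵐ X ∂(multivariateGaussian 0 S), ∀ v : α → ℝ,
      (∀ x, ∑ l, v l * X.ofLp (x + l) = 0) → v = 0 := by
  have hψ : ∀ ψ : AddChar α ℂ, ∀ᵐ X ∂(multivariateGaussian 0 S),
      ∑ x, (X.ofLp x : ℂ) * ψ x ≠ 0 := fun ψ => by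
    have hw : (fun x => (ψ x).re) ≠ 0 := fun h => by simpa using congrFun h 0
    filter_upwards [ae_sum_mul_ne_zero_multivariateGaussian hS hw] with X hX h
    apply hX
    have := congrArg Complex.re h
    simpa using this
  filter_upwards [ae_all_iff.2 hψ] with X hX v hv
  -- The Fourier transform turns the convolution into a product.
  have hv0 : ∀ ψ : AddChar α ℂ, ∑ l, (v l : ℂ) * ψ (-l) = 0 := fun ψ => by
    have h : (∑ l, (v l : ℂ) * ψ (-l)) * ∑ x, (X.ofLp x : ℂ) * ψ x = 0 := by
      calc _ = ∑ l, ∑ x, (v l : ℂ) * ψ (-l) * ((X.ofLp (x + l) : ℂ) * ψ (x + l)) := by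
            rw [Finset.sum_mul]
            refine Finset.sum_congr rfl fun l _ => ?_
            rw [Finset.mul_sum]
            exact (Fintype.sum_equiv (Equiv.addRight l) _ _ fun x => by simp).symm
        _ = ∑ x, ((∑ l, v l * X.ofLp (x + l) : ℝ) : ℂ) * ψ x := by
            rw [Finset.sum_comm]
            refine Finset.sum_congr rfl fun x _ => ?_
            push_cast
            rw [Finset.sum_mul]
            refine Finset.sum_congr rfl fun l _ => ?_
            have : ψ x = ψ (-l) * ψ (x + l) := by rw [← AddChar.map_add_eq_mul]; simp
            rw [this]; ring
        _ = 0 := by simp [hv]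
    exact (mul_eq_zero.1 h).resolve_right (hX ψ)
  set Λ : (α → ℂ) →ₗ[ℂ] ℂ := ∑ l, (v l : ℂ) • LinearMap.proj (-l) with hΛ
  have hΛ0 : Λ = 0 := (AddChar.complexBasis α).ext fun ψ => by
    rw [AddChar.complexBasis_apply]
    simpa [hΛ] using hv0 ψ
  ext l
  have := LinearMap.congr_fun hΛ0 (Pi.single (-l) 1)
  simpa [hΛ, Pi.single_apply] using this

end GaussianQuadraticForms

/-! ### Extreme eigenvalues of symmetric matrices -/

section Spectrum

open Matrix

variable {ι : Type*} [Fintype ι]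

lemma dotProduct_self_pos {x : ι → ℝ} (hx : x ≠ 0) : 0 < x ⬝ᵥ x := by
  simpa using dotProduct_star_self_pos_iff.2 hx

lemma dotProduct_self_nonneg (x : ι → ℝ) : 0 ≤ x ⬝ᵥ x := by
  simpa using dotProduct_star_self_nonneg x

lemma dotProduct_sq_le_mul_self (x y : ι → ℝ) : (x ⬝ᵥ y) ^ 2 ≤ (x ⬝ᵥ x) * (y ⬝ᵥ y) := by
  simpa [dotProduct, sq] using Finset.sum_mul_sq_le_sq_mul_sq Finset.univ x y

/-- If `A ≥ c > 0` then `|A x|² ≥ c² |x|²`. -/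
lemma sq_mul_dotProduct_le_of_mul_dotProduct_le {A : Matrix ι ι ℝ} {c : ℝ} (hc : 0 < c)
    {x : ι → ℝ} (h : c * (x ⬝ᵥ x) ≤ x ⬝ᵥ A *ᵥ x) :
    c ^ 2 * (x ⬝ᵥ x) ≤ (A *ᵥ x) ⬝ᵥ (A *ᵥ x) := by
  rcases eq_or_ne x 0 with rfl | hx
  · simp
  have h0 := dotProduct_self_pos hx
  have h1 := dotProduct_sq_le_mul_self x (A *ᵥ x)
  have h2 : (c * (x ⬝ᵥ x)) ^ 2 ≤ (x ⬝ᵥ A *ᵥ x) ^ 2 := by gcongr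
  refine le_of_mul_le_mul_left ?_ h0
  nlinarith

/-- If `A ≥ c > 0` then `A² ≥ c A`. -/
lemma mul_dotProduct_mulVec_le {A : Matrix ι ι ℝ} {c : ℝ} (hc : 0 < c)
    {x : ι → ℝ} (h : c * (x ⬝ᵥ x) ≤ x ⬝ᵥ A *ᵥ x) :
    c * (x ⬝ᵥ A *ᵥ x) ≤ (A *ᵥ x) ⬝ᵥ (A *ᵥ x) := by
  have h0 := dotProduct_self_nonneg x
  have h1 := dotProduct_sq_le_mul_self x (A *ᵥ x)
  have h2 := dotProduct_self_nonneg (A *ᵥ x)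
  by_contra hlt
  push Not at hlt
  have h3 : 0 < x ⬝ᵥ A *ᵥ x := by
    by_contra h4
    push Not at h4
    nlinarith
  nlinarith [mul_pos h3 h3]

variable [DecidableEq ι]

lemma dotProduct_mulVec_eq_sum_eigenvalues {A : Matrix ι ι ℝ} (hA : A.IsHermitian) (x : ι → ℝ) :
    ∃ c : ι → ℝ, x ⬝ᵥ A *ᵥ x = ∑ i, hA.eigenvalues i * c i ^ 2 ∧ x ⬝ᵥ x = ∑ i, c i ^ 2 := by
  set b := hA.eigenvectorBasis
  set c : ι → ℝ := fun i => b.repr (WithLp.toLp 2 x) i with hc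
  have hx : x = (∑ i, c i • b i).ofLp := by rw [b.sum_repr]
  have hAx : A *ᵥ x = (∑ i, (hA.eigenvalues i * c i) • b i).ofLp := by
    rw [hx]
    simp only [WithLp.ofLp_sum, WithLp.ofLp_smul, mulVec_sum, mulVec_smul, b,
      hA.mulVec_eigenvectorBasis, smul_smul]
    simp [mul_comm]
  have h3 : ∀ u v : EuclideanSpace ℝ ι, u.ofLp ⬝ᵥ v.ofLp = inner ℝ u v := fun u v => by
    simp [PiLp.inner_apply, dotProduct, mul_comm]
  refine ⟨c, ?_, ?_⟩
  · rw [hAx]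
    conv_lhs => rw [hx]
    rw [h3, b.orthonormal.inner_sum]
    refine Finset.sum_congr rfl fun i _ => ?_
    simp; ring
  · conv_lhs => rw [hx]
    rw [h3, b.orthonormal.inner_sum]
    refine Finset.sum_congr rfl fun i _ => ?_
    simp [sq]

lemma phiMin_mul_dotProduct_le {A : Matrix ι ι ℝ} (hA : A.IsHermitian) (x : ι → ℝ) :
    phiMin A * (x ⬝ᵥ x) ≤ x ⬝ᵥ A *ᵥ x := by
  obtain ⟨c, h1, h2⟩ := dotProduct_mulVec_eq_sum_eigenvalues hA x
  rw [h1, h2, Finset.mul_sum]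
  gcongr with i
  refine csInf_le A.finite_real_spectrum.bddBelow ?_
  rw [hA.spectrum_real_eq_range_eigenvalues]
  exact ⟨i, rfl⟩

lemma dotProduct_mulVec_le_phiMax_mul {A : Matrix ι ι ℝ} (hA : A.IsHermitian) (x : ι → ℝ) :
    x ⬝ᵥ A *ᵥ x ≤ phiMax A * (x ⬝ᵥ x) := by
  obtain ⟨c, h1, h2⟩ := dotProduct_mulVec_eq_sum_eigenvalues hA x
  rw [h1, h2, Finset.mul_sum]
  gcongr with i
  refine le_csSup A.finite_real_spectrum.bddAbove ?_
  rw [hA.spectrum_real_eq_range_eigenvalues]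
  exact ⟨i, rfl⟩

lemma exists_eigenvector_of_mem_spectrum {A : Matrix ι ι ℝ} {μ : ℝ} (h : μ ∈ spectrum ℝ A) :
    ∃ v : ι → ℝ, v ≠ 0 ∧ A *ᵥ v = μ • v := by
  rw [← spectrum_toLin', ← Module.End.hasEigenvalue_iff_mem_spectrum] at h
  obtain ⟨v, hv⟩ := h.exists_hasEigenvector
  exact ⟨v, hv.2, by simpa using hv.apply_eq_smul⟩

lemma mem_spectrum_of_eigenvector {A : Matrix ι ι ℝ} {μ : ℝ} {v : ι → ℝ} (hv : v ≠ 0)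
    (h : A *ᵥ v = μ • v) : μ ∈ spectrum ℝ A := by
  rw [← spectrum_toLin', ← Module.End.hasEigenvalue_iff_mem_spectrum]
  exact Module.End.hasEigenvalue_of_hasEigenvector (x := v)
    ⟨Module.End.mem_eigenspace_iff.2 (by simpa using h), hv⟩

lemma spectrum_nonempty_of_isHermitian [Nonempty ι] {A : Matrix ι ι ℝ} (hA : A.IsHermitian) :
    (spectrum ℝ A).Nonempty := by
  rw [hA.spectrum_real_eq_range_eigenvalues]; exact Set.range_nonempty _

lemma phiMax_le [Nonempty ι] {A : Matrix ι ι ℝ} (hA : A.IsHermitian) {c : ℝ}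
    (h : ∀ x : ι → ℝ, x ⬝ᵥ A *ᵥ x ≤ c * (x ⬝ᵥ x)) : phiMax A ≤ c := by
  refine csSup_le (spectrum_nonempty_of_isHermitian hA) fun μ hμ => ?_
  obtain ⟨v, hv0, hv⟩ := exists_eigenvector_of_mem_spectrum hμ
  have := h v
  rw [hv, dotProduct_smul, smul_eq_mul] at this
  exact le_of_mul_le_mul_right this (dotProduct_self_pos hv0)

lemma phiMin_mem_spectrum [Nonempty ι] {A : Matrix ι ι ℝ} (hA : A.IsHermitian) :
    phiMin A ∈ spectrum ℝ A :=
  (spectrum_nonempty_of_isHermitian hA).csInf_mem A.finite_real_spectrum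

lemma phiMin_pos [Nonempty ι] {A : Matrix ι ι ℝ} (hA : A.PosDef) : 0 < phiMin A := by
  obtain ⟨v, hv0, hv⟩ := exists_eigenvector_of_mem_spectrum (phiMin_mem_spectrum hA.isHermitian)
  have := hA.dotProduct_mulVec_pos hv0
  rw [hv, star_trivial, dotProduct_smul, smul_eq_mul] at this
  exact (pos_iff_pos_of_mul_pos this).2 (dotProduct_self_pos hv0)

lemma phiMax_smul_inv [Nonempty ι] {A : Matrix ι ι ℝ} (hA : A.PosDef) {a : ℝ} (ha : 0 < a) :
    phiMax (a • A⁻¹) = a / phiMin A := by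
  have hφ := phiMin_pos hA
  have hu : IsUnit A.det := (Matrix.isUnit_iff_isUnit_det A).1 hA.isUnit
  have hAi : (a • A⁻¹).IsHermitian := (hA.inv.smul ha).isHermitian
  apply le_antisymm
  · refine phiMax_le hAi fun x => ?_
    have hx : x = A *ᵥ (A⁻¹ *ᵥ x) := by rw [mulVec_mulVec, mul_nonsing_inv _ hu, one_mulVec]
    set y := A⁻¹ *ᵥ x with hy
    have h1 := mul_dotProduct_mulVec_le hφ (phiMin_mul_dotProduct_le hA.isHermitian y)
    rw [← hx] at h1
    rw [smul_mulVec, dotProduct_smul, smul_eq_mul, ← hy, dotProduct_comm, div_mul_eq_mul_div,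
      le_div_iff₀ hφ]
    nlinarith
  · obtain ⟨v, hv0, hv⟩ := exists_eigenvector_of_mem_spectrum (phiMin_mem_spectrum hA.isHermitian)
    refine le_csSup (a • A⁻¹).finite_real_spectrum.bddAbove (mem_spectrum_of_eigenvector hv0 ?_)
    have h1 : A⁻¹ *ᵥ (A *ᵥ v) = v := by rw [mulVec_mulVec, nonsing_inv_mul _ hu, one_mulVec]
    rw [hv, mulVec_smul] at h1
    rw [smul_mulVec, div_eq_mul_inv, mul_smul, ← (eq_inv_smul_iff₀ hφ.ne').2 h1]

end Spectrum

/-! ### Orthonormal bases of bilinear forms -/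

section Orthonormal

/-- A positive definite symmetric bilinear form on a finite-dimensional space has an orthonormal
basis. -/
lemma exists_basis_orthonormal {V : Type*} [AddCommGroup V] [Module ℝ V] [FiniteDimensional ℝ V]
    (B : LinearMap.BilinForm ℝ V) (hs : LinearMap.IsSymm B) (hpos : ∀ v, v ≠ 0 → 0 < B v v) :
    ∃ e : Module.Basis (Fin (Module.finrank ℝ V)) ℝ V,
      ∀ i j, B (e i) (e j) = if i = j then 1 else 0 := by
  obtain ⟨b, hb⟩ := LinearMap.BilinForm.exists_orthogonal_basis hs
  have hp : ∀ i, 0 < √(B (b i) (b i)) := fun i => Real.sqrt_pos.2 (hpos _ (b.ne_zero i))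
  refine ⟨b.isUnitSMul (w := fun i => (√(B (b i) (b i)))⁻¹)
    (fun i => (inv_ne_zero (hp i).ne').isUnit), fun i j => ?_⟩
  simp only [Module.Basis.isUnitSMul_apply, map_smul, LinearMap.smul_apply, smul_eq_mul]
  split_ifs with h
  · subst h
    have h2 := Real.mul_self_sqrt (hpos _ (b.ne_zero i)).le
    have := (hp i).ne'
    field_simp
    nlinarith
  · have h2 : B (b i) (b j) = 0 := hb h
    rw [h2]; simp

end Orthonormal

/-! ### Block circulant matrices and the loss form -/

section Torus

open Matrix

variable {p : ℕ}

lemma circ_add (a b : Param p) : circ (a + b) = circ a + circ b := rfl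

lemma circ_sub (a b : Param p) : circ (a - b) = circ a - circ b := rfl

lemma circ_smul (c : ℝ) (a : Param p) : circ (c • a) = c • circ a := rfl

lemma circ_eq_circulant {a : Param p} (ha : a ∈ Theta p) : circ a = circulant a := by
  ext x y
  rw [circulant_apply, ← neg_sub y x, ha.2]
  rfl

lemma circ_isHermitian {a : Param p} (ha : a ∈ Theta p) : (circ a).IsHermitian := by
  ext x y
  simp only [circ, conjTranspose_apply, of_apply, star_trivial]
  rw [← neg_sub y x, ha.2]

lemma transpose_circ {a : Param p} (ha : a ∈ Theta p) : (circ a)ᵀ = circ a := by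
  simpa using (circ_isHermitian ha).eq

lemma one_sub_circ_isHermitian {a : Param p} (ha : a ∈ Theta p) : (1 - circ a).IsHermitian :=
  isHermitian_one.sub (circ_isHermitian ha)

lemma one_sub_circ_eq_circulant {θ : Param p} (hθ : θ ∈ Theta p) :
    1 - circ θ = circulant (Pi.single 0 1 - θ) := by
  rw [circulant_sub, circulant_single_one, circ_eq_circulant hθ]

variable [NeZero p]

lemma circ_commute (a b : Param p) : Commute (circ a) (circ b) := by
  have h : ∀ c : Param p, circ c = (circulant c)ᵀ := fun c => rfl
  rw [Commute, SemiconjBy, h, h, ← transpose_mul, ← transpose_mul, circulant_mul_comm]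

lemma one_sub_circ_commute (a b : Param p) : Commute (circ a) (1 - circ b) :=
  (Commute.one_right _).sub_right (circ_commute a b)

lemma inv_commute {ι : Type*} [Fintype ι] [DecidableEq ι] {A B : Matrix ι ι ℝ} (h : Commute A B) :
    Commute A B⁻¹ := by
  simpa using Matrix.Commute.zpow_right h (-1)

lemma circ_mulVec (a : Param p) (X : Lattice p → ℝ) (j : Lattice p) :
    (circ a *ᵥ X) j = ∑ l, a l * X (j + l) := by
  simp only [mulVec, dotProduct, circ, of_apply]
  exact Fintype.sum_equiv (Equiv.subRight j) _ _ fun x => by simp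

lemma circ_mulVec_of_mem_theta {a : Param p} (ha : a ∈ Theta p) (X : Lattice p → ℝ)
    (j : Lattice p) :
    (circ a *ᵥ X) j = ∑ l ∈ Finset.univ.erase (0 : Lattice p), a l * X (j + l) := by
  rw [circ_mulVec, ← Finset.add_sum_erase _ _ (Finset.mem_univ (0 : Lattice p)), ha.1]
  simp

/-- Schur's bound for a circulant quadratic form. -/
lemma abs_dotProduct_circ_mulVec_le (a : Param p) (x : Lattice p → ℝ) :
    |x ⬝ᵥ circ a *ᵥ x| ≤ l1norm a * (x ⬝ᵥ x) := by
  have h : x ⬝ᵥ circ a *ᵥ x = ∑ l, a l * ∑ j, x j * x (j + l) := by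
    simp only [dotProduct, circ_mulVec, Finset.mul_sum]
    rw [Finset.sum_comm]
    exact Finset.sum_congr rfl fun l _ => Finset.sum_congr rfl fun j _ => by ring
  rw [h, l1norm, Finset.sum_mul]
  refine (Finset.abs_sum_le_sum_abs _ _).trans (Finset.sum_le_sum fun l _ => ?_)
  rw [abs_mul]
  gcongr
  have hs : ∑ j, x (j + l) * x (j + l) = x ⬝ᵥ x :=
    Fintype.sum_equiv (Equiv.addRight l) _ _ fun j => rfl
  calc |∑ j, x j * x (j + l)| ≤ ∑ j, |x j * x (j + l)| := Finset.abs_sum_le_sum_abs _ _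
    _ ≤ ∑ j, (x j * x j + x (j + l) * x (j + l)) / 2 := by
        refine Finset.sum_le_sum fun j _ => abs_le.2 ⟨?_, ?_⟩ <;>
          nlinarith [sq_nonneg (x j + x (j + l)), sq_nonneg (x j - x (j + l))]
    _ = x ⬝ᵥ x := by
        rw [← Finset.sum_div, Finset.sum_add_distrib, hs]; simp only [dotProduct]; ring

lemma dotProduct_one_sub_circ_mulVec (a : Param p) (x : Lattice p → ℝ) :
    x ⬝ᵥ (1 - circ a) *ᵥ x = x ⬝ᵥ x - x ⬝ᵥ circ a *ᵥ x := by
  rw [sub_mulVec, one_mulVec, dotProduct_sub]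

/-- On `Θ⁺` the entries are bounded by `1`: test positivity on two nodes. -/
lemma abs_apply_le_one {a : Param p} (ha : a ∈ ThetaPlus p) (x : Lattice p) : |a x| ≤ 1 := by
  rcases eq_or_ne x 0 with rfl | hx
  · simp [ha.1.1]
  have key : ∀ c : ℝ, c ^ 2 = 1 → 0 ≤ 2 - 2 * c * a x := fun c hc => by
    have h := ha.2.posSemidef.dotProduct_mulVec_nonneg
      (Pi.single (0 : Lattice p) (1 : ℝ) + Pi.single x c)
    have hs : circ a x 0 = a x := by simp [circ, ha.1.2]
    have h0 : ∀ y, circ a y y = 0 := fun y => by simp [circ, ha.1.1]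
    have hs' : circ a 0 x = a x := by simp [circ]
    simp only [star_trivial, mulVec_add, mulVec_single, dotProduct_add, add_dotProduct,
      single_dotProduct, MulOpposite.op_one, one_smul, col_apply, Matrix.sub_apply, one_apply_eq,
      h0, one_apply_ne hx, one_apply_ne hx.symm, hs, hs', one_mul, Pi.smul_apply,
      MulOpposite.smul_eq_mul_unop, MulOpposite.unop_op] at h
    nlinarith
  rw [abs_le]
  constructor
  · linarith [key (-1) (by norm_num)]
  · linarith [key 1 (by norm_num)]

lemma cov_posDef {σ : ℝ} (hσ : 0 < σ) {θ : Param p} (hθ : θ ∈ ThetaPlus p) : (cov σ θ).PosDef :=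
  hθ.2.inv.smul (by positivity)

lemma isUnit_det_one_sub_circ {θ : Param p} (hθ : θ ∈ ThetaPlus p) : IsUnit (1 - circ θ).det :=
  (Matrix.isUnit_iff_isUnit_det _).1 hθ.2.isUnit

lemma inv_mul_circ {θ v : Param p} (hθ : θ ∈ ThetaPlus p) (hv : v ∈ Theta p) :
    (1 - circ θ)⁻¹ * circ v = circulant ((1 - circ θ)⁻¹ *ᵥ v) := by
  have h : (1 - circ θ) * circulant ((1 - circ θ)⁻¹ *ᵥ v) = circ v := by
    conv_lhs => enter [1]; rw [one_sub_circ_eq_circulant hθ.1]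
    rw [circulant_mul, ← one_sub_circ_eq_circulant hθ.1, mulVec_mulVec,
      mul_nonsing_inv _ (isUnit_det_one_sub_circ hθ), one_mulVec, circ_eq_circulant hv]
  rw [← h, ← Matrix.mul_assoc, nonsing_inv_mul _ (isUnit_det_one_sub_circ hθ), Matrix.one_mul]

lemma card_lattice : (Fintype.card (Lattice p) : ℝ) = (p : ℝ) ^ 2 := by
  simp [Lattice, ZMod.card, sq]

/-- The bilinear form whose quadratic form is the loss. -/
noncomputable def lossForm (σ : ℝ) (θ : Param p) : LinearMap.BilinForm ℝ (Param p) :=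
  LinearMap.mk₂ ℝ (fun v w => 1 / (p : ℝ) ^ 2 * (circ v * cov σ θ * circ w).trace)
    (fun a b w => by simp only [circ_add, Matrix.add_mul, trace_add, mul_add])
    (fun c a w => by simp only [circ_smul, Matrix.smul_mul, trace_smul, smul_eq_mul]; ring)
    (fun a b w => by simp only [circ_add, trace_add, mul_add])
    (fun c a w => by simp only [circ_smul, Matrix.mul_smul, trace_smul, smul_eq_mul]; ring)

lemma lossForm_apply (σ : ℝ) (θ v w : Param p) :
    lossForm σ θ v w = 1 / (p : ℝ) ^ 2 * (circ v * cov σ θ * circ w).trace := rfl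

lemma loss_eq_lossForm (σ : ℝ) (θ a b : Param p) :
    loss σ θ a b = lossForm σ θ (a - b) (a - b) := rfl

lemma lossForm_eq_dotProduct {σ : ℝ} {θ v w : Param p} (hθ : θ ∈ ThetaPlus p)
    (hv : v ∈ Theta p) (hw : w ∈ Theta p) :
    lossForm σ θ v w = σ ^ 2 * (v ⬝ᵥ (1 - circ θ)⁻¹ *ᵥ w) := by
  have h : ∀ u : Param p, (circulant v * circulant u).trace = (p : ℝ) ^ 2 * (v ⬝ᵥ u) := fun u => by
    rw [circulant_mul, trace, ← card_lattice]
    simp only [diag_apply, circulant_apply, sub_self, Finset.sum_const, Finset.card_univ,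
      nsmul_eq_mul]
    congr 1
    simp [mulVec, dotProduct, hv.2]
  have hp : (p : ℝ) ≠ 0 := Nat.cast_ne_zero.2 (NeZero.ne p)
  rw [lossForm_apply, cov, Matrix.mul_smul, Matrix.smul_mul, trace_smul, Matrix.mul_assoc,
    inv_mul_circ hθ hw, circ_eq_circulant hv, h, smul_eq_mul]
  field_simp

lemma lossForm_symm {σ : ℝ} {θ v w : Param p} (hθ : θ ∈ ThetaPlus p)
    (hv : v ∈ Theta p) (hw : w ∈ Theta p) : lossForm σ θ v w = lossForm σ θ w v := by
  have h : ((1 - circ θ)⁻¹)ᵀ = (1 - circ θ)⁻¹ := by simpa using hθ.2.inv.isHermitian.eq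
  rw [lossForm_eq_dotProduct hθ hv hw, lossForm_eq_dotProduct hθ hw hv, dotProduct_mulVec,
    ← mulVec_transpose, h, dotProduct_comm]

lemma lossForm_pos {σ : ℝ} (hσ : 0 < σ) {θ v : Param p} (hθ : θ ∈ ThetaPlus p)
    (hv : v ∈ Theta p) (hv0 : v ≠ 0) : 0 < lossForm σ θ v v := by
  rw [lossForm_eq_dotProduct hθ hv hv]
  have := hθ.2.inv.dotProduct_mulVec_pos hv0
  rw [star_trivial] at this
  positivity

lemma exists_basis_orthonormal_lossForm {σ : ℝ} (hσ : 0 < σ) {θ : Param p} (hθ : θ ∈ ThetaPlus p)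
    (m : Set (Lattice p)) :
    ∃ e : Module.Basis (Fin (dimModel m)) ℝ (ThetaModel m),
      ∀ i j, lossForm σ θ (e i) (e j) = if i = j then 1 else 0 :=
  exists_basis_orthonormal ((lossForm σ θ).restrict (ThetaModel m))
    ⟨fun v w => lossForm_symm hθ v.2.1 w.2.1⟩
    (fun v hv => lossForm_pos hσ hθ v.2.1 (by simpa using hv))

/-- Every linear functional on a model is represented by the loss form. -/
lemma exists_lossForm_eq {σ : ℝ} (hσ : 0 < σ) {θ : Param p} (hθ : θ ∈ ThetaPlus p)
    (m : Set (Lattice p)) (ℓ : Param p →ₗ[ℝ] ℝ) :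
    ∃ v ∈ ThetaModel m, ∀ w ∈ ThetaModel m, lossForm σ θ w v = ℓ w := by
  obtain ⟨e, he⟩ := exists_basis_orthonormal_lossForm hσ hθ m
  refine ⟨∑ i, ℓ (e i) • (e i : Param p), sum_mem fun i _ => Submodule.smul_mem _ _ (e i).2,
    fun w hw => ?_⟩
  have h : (lossForm σ θ).flip (∑ i, ℓ (e i) • (e i : Param p)) ∘ₗ (ThetaModel m).subtype =
      ℓ ∘ₗ (ThetaModel m).subtype := e.ext fun j => by
    simp [he]
  exact LinearMap.congr_fun h ⟨w, hw⟩

/-! ### The projection on a model under `‖θ‖₁ < 1` -/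

/-- Maximum principle: if the values of `h` off a set are the averages of `h` with weights `θ`,
`‖θ‖₁ < 1`, and `|h| ≤ 1` on the set, then `|h| ≤ ‖θ‖₁` off the set. -/
lemma abs_le_l1norm_of_harmonic {θ : Param p} (hθ : l1norm θ < 1) {h : Lattice p → ℝ}
    {A : Set (Lattice p)} (hA : ∀ x ∈ A, |h x| ≤ 1)
    (hh : ∀ x ∉ A, h x = ∑ l, θ l * h (x + l)) : ∀ x ∉ A, |h x| ≤ l1norm θ := by
  have h0 : 0 ≤ l1norm θ := Finset.sum_nonneg fun x _ => abs_nonneg _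
  obtain ⟨x₀, hx₀⟩ := Finite.exists_max fun x => |h x|
  have hle : ∀ x ∉ A, |h x| ≤ l1norm θ * |h x₀| := fun x hx => by
    rw [hh x hx, l1norm, Finset.sum_mul]
    refine (Finset.abs_sum_le_sum_abs _ _).trans (Finset.sum_le_sum fun l _ => ?_)
    rw [abs_mul]
    exact mul_le_mul_of_nonneg_left (hx₀ _) (abs_nonneg _)
  have h1 : |h x₀| ≤ 1 := by
    by_cases hx : x₀ ∈ A
    · exact hA _ hx
    · nlinarith [hle x₀ hx, abs_nonneg (h x₀)]
  exact fun x hx => (hle x hx).trans (by nlinarith)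

/-- The projection of `θ` on a model has `l₁` norm at most `‖θ‖₁`. With `s` the sign vector of the
projection `β`, let `v` in the model be such that `h = (I - C(θ))⁻¹ v` agrees with `s` on the model;
then `‖β‖₁ = h 0`, and `h` obeys the maximum principle off the model. -/
lemma exists_projection_l1norm_le {σ : ℝ} (hσ : 0 < σ) {θ : Param p} (hθ : θ ∈ ThetaPlus p)
    (h1 : l1norm θ < 1) (m : Set (Lattice p)) :
    ∃ β ∈ ThetaModel m, (∀ w ∈ ThetaModel m, lossForm σ θ w (θ - β) = 0) ∧
      l1norm β ≤ l1norm θ := by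
  obtain ⟨β, hβ, hβw⟩ := exists_lossForm_eq hσ hθ m ((lossForm σ θ).flip θ)
  refine ⟨β, hβ, fun w hw => by rw [map_sub, hβw w hw]; simp, ?_⟩
  set s : Param p := fun x => (SignType.sign (β x) : ℝ) with hs
  set D := (1 - circ θ)⁻¹ with hD
  have hDt : Dᵀ = D := by simpa using hθ.2.inv.isHermitian.eq
  obtain ⟨v, hv, hvw⟩ := exists_lossForm_eq hσ hθ m (σ ^ 2 • ∑ x, s x • LinearMap.proj x)
  set h := D *ᵥ v with hh
  have hσ2 : σ ^ 2 ≠ 0 := by positivity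
  have hvs : ∀ w ∈ ThetaModel m, w ⬝ᵥ h = w ⬝ᵥ s := fun w hw => by
    have := hvw w hw
    rw [lossForm_eq_dotProduct hθ hw.1 hv.1] at this
    have := mul_left_cancel₀ hσ2 (this.trans
      (by simp : _ = σ ^ 2 * ∑ x, s x * w x))
    rw [← hD, ← hh] at this
    rw [this, dotProduct_comm]; rfl
  have hPh : (1 - circ θ) *ᵥ h = v := by
    rw [hh, hD, mulVec_mulVec, mul_nonsing_inv _ (isUnit_det_one_sub_circ hθ), one_mulVec]
  have hsym : ∀ x, h (-x) = h x := by
    refine circulant_isSymm_iff.1 ?_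
    rw [← inv_mul_circ hθ hv.1, IsSymm, transpose_mul, transpose_circ hv.1, hDt]
    exact (inv_commute (one_sub_circ_commute v θ)).eq
  -- The support of a generic element of the model.
  set A : Set (Lattice p) := {x | x ≠ 0 ∧ x ∈ m ∧ -x ∈ m} with hA
  have hsA : ∀ x, s (-x) = s x := fun x => by simp only [hs, hβ.1.2]
  have hmem : A.indicator (h - s) ∈ ThetaModel m := by
    refine ⟨⟨by simp [hA], fun x => ?_⟩, fun x hx => by simp [hA, hx]⟩
    have : -x ∈ A ↔ x ∈ A := by simp [hA, and_comm]
    by_cases hx : x ∈ A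
    · rw [Set.indicator_of_mem hx, Set.indicator_of_mem (this.2 hx)]
      simp [hsym, hsA]
    · rw [Set.indicator_of_notMem hx, Set.indicator_of_notMem (mt this.1 hx)]
  -- Test the definition of `v` on the restriction of `h - s` to `A`.
  have hhs : ∀ x ∈ A, h x = s x := by
    have h2 : A.indicator (h - s) ⬝ᵥ (h - s) = 0 := by
      rw [dotProduct_sub, hvs _ hmem, sub_self]
    have h3 : ∑ x, A.indicator (h - s) x ^ 2 = 0 := by
      rw [← h2]
      refine Finset.sum_congr rfl fun x _ => ?_
      by_cases hx : x ∈ A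
      · rw [Set.indicator_of_mem hx, sq]
      · rw [Set.indicator_of_notMem hx]; simp
    intro x hx
    have := (Finset.sum_eq_zero_iff_of_nonneg fun x _ => sq_nonneg _).1 h3 x (Finset.mem_univ x)
    rw [Set.indicator_of_mem hx] at this
    simpa [sub_eq_zero] using this
  have hbound : |h 0| ≤ l1norm θ := by
    refine abs_le_l1norm_of_harmonic h1 (A := A) (fun x hx => ?_) (fun x hx => ?_) 0 (by simp [hA])
    · rw [hhs x hx, hs]
      rcases lt_trichotomy (β x) 0 with h | h | h <;> simp [h]
    · have hvx : v x = 0 := by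
        by_cases hx0 : x = 0
        · rw [hx0, hv.1.1]
        by_cases hxm : x ∈ m
        · rw [← hv.1.2]
          exact hv.2 _ fun hxm' => hx ⟨hx0, hxm, hxm'⟩
        · exact hv.2 _ hxm
      have := congrFun hPh x
      rw [hvx, sub_mulVec, one_mulVec, Pi.sub_apply, circ_mulVec, sub_eq_zero] at this
      exact this
  -- The column of `P⁻¹ C(θ) = P⁻¹ - I` at the origin.
  have hcol : D *ᵥ θ = D *ᵥ Pi.single 0 1 - Pi.single 0 1 := by
    have : (1 - circ θ) *ᵥ Pi.single 0 1 = Pi.single 0 1 - θ := by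
      rw [sub_mulVec, one_mulVec]
      congr 1
      ext x
      simp [circ, hθ.1.2]
    have h2 := congrArg (D *ᵥ ·) this
    simp only [mulVec_mulVec, hD, nonsing_inv_mul _ (isUnit_det_one_sub_circ hθ), one_mulVec,
      mulVec_sub] at h2
    rw [eq_sub_iff_add_eq']
    exact eq_sub_iff_add_eq.1 h2
  have hβv : v ⬝ᵥ D *ᵥ β = v ⬝ᵥ D *ᵥ θ := by
    have : lossForm σ θ v β = lossForm σ θ v θ := hβw v hv
    rw [lossForm_eq_dotProduct hθ hv.1 hβ.1,
      lossForm_eq_dotProduct hθ hv.1 hθ.1] at this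
    exact mul_left_cancel₀ hσ2 this
  have hnorm : l1norm β = h 0 := by
    calc l1norm β = β ⬝ᵥ s := by
          refine Finset.sum_congr rfl fun x _ => ?_
          rw [hs, self_mul_sign]
      _ = v ⬝ᵥ D *ᵥ β := by
          rw [← hvs β hβ, hh, dotProduct_mulVec, ← mulVec_transpose, hDt, dotProduct_comm]
      _ = (D *ᵥ v) ⬝ᵥ Pi.single 0 1 - v 0 := by
          rw [hβv, hcol, dotProduct_sub, dotProduct_mulVec, ← mulVec_transpose, hDt,
            dotProduct_single, dotProduct_single]
          simp
      _ = h 0 := by rw [hv.1.1, dotProduct_single, hh]; simp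
  rw [hnorm]
  exact (le_abs_self _).trans hbound

end Torus

/-! ### Measurability of minimizers -/

section Argmin

/-- The value at the minimizer of a jointly continuous criterion over a compact set is measurable
as soon as the minimizer is almost surely unique, because the minimizer depends continuously on the
data wherever it is unique. -/
lemma aestronglyMeasurable_comp_argmin {X Y : Type*} [TopologicalSpace X] [MeasurableSpace X]
    [OpensMeasurableSpace X] [TopologicalSpace Y] {μ : Measure X} {K : Set Y} (hK : IsCompact K)
    {f : X → Y → ℝ} (hf : Continuous (Function.uncurry f)) {t : X → Y} (htK : ∀ x, t x ∈ K)
    (ht : ∀ x, ∀ y ∈ K, f x (t x) ≤ f x y)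
    (hu : ∀ᵐ x ∂μ, ∀ y ∈ K, (∀ z ∈ K, f x y ≤ f x z) → y = t x)
    {F : Y → ℝ} (hF : Continuous F) : AEStronglyMeasurable (fun x => F (t x)) μ := by
  set s := (toMeasurable μ {x | ¬ ∀ y ∈ K, (∀ z ∈ K, f x y ≤ f x z) → y = t x})ᶜ with hs
  have hsm : MeasurableSet s := (measurableSet_toMeasurable _ _).compl
  have hsu : ∀ x ∈ s, ∀ y ∈ K, (∀ z ∈ K, f x y ≤ f x z) → y = t x := fun x hx => by
    by_contra h
    exact hx (subset_toMeasurable _ _ h)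
  have hμs : ∀ᵐ x ∂μ, x ∈ s := by
    refine measure_eq_zero_iff_ae_notMem.1 ?_
    rw [measure_toMeasurable]
    exact ae_iff.1 hu
  have hcont : ContinuousOn t s := fun x₀ hx₀ => by
    refine hK.tendsto_nhds_of_unique_mapClusterPt (Eventually.of_forall htK) fun y hy hcl => ?_
    refine hsu x₀ hx₀ y hy fun z hz => ?_
    obtain ⟨U, hU, hUy⟩ := mapClusterPt_iff_ultrafilter.1 hcl
    have hUx : Tendsto id (U : Filter X) (𝓝 x₀) := hU.trans nhdsWithin_le_nhds
    have h1 : Tendsto (fun x => f x (t x)) U (𝓝 (f x₀ y)) :=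
      (hf.tendsto (x₀, y)).comp (hUx.prodMk_nhds hUy)
    have h2 : Tendsto (fun x => f x z) U (𝓝 (f x₀ z)) :=
      (hf.tendsto (x₀, z)).comp (hUx.prodMk_nhds tendsto_const_nhds)
    exact le_of_tendsto_of_tendsto' h1 h2 fun x => ht x z hz
  rw [← Measure.restrict_eq_self_of_ae_mem hμs]
  exact (hF.comp_continuousOn hcont).aestronglyMeasurable hsm

lemma argminOn_spec {p : ℕ} {f : Param p → ℝ} {K : Set (Param p)} (hK : IsCompact K)
    (hne : K.Nonempty) (hf : ContinuousOn f K) :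
    argminOn f K ∈ K ∧ ∀ y ∈ K, f (argminOn f K) ≤ f y := by
  obtain ⟨x, hx, hmin⟩ := hK.exists_isMinOn hne hf
  exact Classical.epsilon_spec (p := fun θ => θ ∈ K ∧ ∀ θ' ∈ K, f θ ≤ f θ')
    ⟨x, hx, fun y hy => hmin hy⟩

end Argmin

/-! ### The parameter set -/

section ParameterSet

open Matrix

variable {p : ℕ} [NeZero p] {m : Set (Lattice p)} {ρ : ℝ}

lemma convex_thetaModelPlusRho : Convex ℝ (ThetaModelPlusRho m ρ) := by
  refine convex_iff_forall_pos.2 fun θ hθ η hη a b ha hb hab => ?_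
  have h : (1 : Matrix (Lattice p) (Lattice p) ℝ) - circ (a • θ + b • η) =
      a • (1 - circ θ) + b • (1 - circ η) := by
    rw [circ_add, circ_smul, circ_smul, smul_sub, smul_sub]
    nth_rewrite 1 [← one_smul ℝ (1 : Matrix (Lattice p) (Lattice p) ℝ), ← hab]
    rw [add_smul]; abel
  have hm : a • θ + b • η ∈ ThetaModel m :=
    add_mem (Submodule.smul_mem _ _ hθ.1.1) (Submodule.smul_mem _ _ hη.1.1)
  refine ⟨⟨hm, hm.1, ?_⟩, ?_⟩
  · rw [h]
    exact (hθ.1.2.2.smul ha).add (hη.1.2.2.smul hb)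
  · have hle : phiMax (1 - circ (a • θ + b • η)) ≤
        a * phiMax (1 - circ θ) + b * phiMax (1 - circ η) := by
      refine phiMax_le (one_sub_circ_isHermitian hm.1) fun x => ?_
      rw [h, add_mulVec, dotProduct_add, smul_mulVec, smul_mulVec, dotProduct_smul,
        dotProduct_smul, smul_eq_mul, smul_eq_mul, add_mul, mul_assoc, mul_assoc]
      gcongr
      · exact dotProduct_mulVec_le_phiMax_mul (one_sub_circ_isHermitian hθ.1.1.1) x
      · exact dotProduct_mulVec_le_phiMax_mul (one_sub_circ_isHermitian hη.1.1.1) x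
    calc _ ≤ _ := hle
      _ < a * ρ + b * ρ := by
          gcongr
          · exact hθ.2
          · exact hη.2
      _ = ρ := by rw [← add_mul, hab, one_mul]

lemma closure_subset_thetaModel : closure (ThetaModelPlusRho m ρ) ⊆ ThetaModel m :=
  closure_minimal (fun _ h => h.1.1) (Submodule.closed_of_finiteDimensional _)

lemma isCompact_closure_thetaModelPlusRho : IsCompact (closure (ThetaModelPlusRho m ρ)) := by
  refine Metric.isCompact_of_isClosed_isBounded isClosed_closure
    (Metric.isBounded_closedBall (x := (0 : Param p)) (r := 1) |>.subset
      (closure_minimal (fun θ hθ => ?_) Metric.isClosed_closedBall))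
  rw [mem_closedBall_zero_iff, pi_norm_le_iff_of_nonneg zero_le_one]
  exact fun x => abs_apply_le_one hθ.1.2 x

/-- `Θ⁺_{m,ρ}` is open in `Θ_m`. -/
lemma exists_add_mem_thetaModelPlusRho {β : Param p} (hβ : β ∈ ThetaModelPlusRho m ρ) :
    ∃ δ > 0, ∀ v ∈ ThetaModel m, l1norm v ≤ δ → β + v ∈ ThetaModelPlusRho m ρ := by
  have hφ := phiMin_pos hβ.1.2.2
  have hA := one_sub_circ_isHermitian hβ.1.1.1
  refine ⟨min (phiMin (1 - circ β)) (ρ - phiMax (1 - circ β)) / 2,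
    half_pos (lt_min hφ (sub_pos.2 hβ.2)), fun v hv hvδ => ?_⟩
  have hm : β + v ∈ ThetaModel m := add_mem hβ.1.1 hv
  have hv1 : l1norm v ≤ phiMin (1 - circ β) / 2 :=
    hvδ.trans (by gcongr; exact min_le_left _ _)
  have hv2 : l1norm v ≤ (ρ - phiMax (1 - circ β)) / 2 :=
    hvδ.trans (by gcongr; exact min_le_right _ _)
  have h : ∀ x, x ⬝ᵥ (1 - circ (β + v)) *ᵥ x = x ⬝ᵥ (1 - circ β) *ᵥ x - x ⬝ᵥ circ v *ᵥ x :=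
    fun x => by rw [circ_add, ← sub_sub, sub_mulVec, dotProduct_sub]
  refine ⟨⟨hm, hm.1, ?_⟩, ?_⟩
  · refine PosDef.of_dotProduct_mulVec_pos (one_sub_circ_isHermitian hm.1) fun x hx => ?_
    rw [star_trivial, h]
    have h0 := dotProduct_self_pos hx
    have h1 := phiMin_mul_dotProduct_le hA x
    have h2 := (abs_le.1 (abs_dotProduct_circ_mulVec_le v x)).2
    nlinarith
  · have hle : phiMax (1 - circ (β + v)) ≤ phiMax (1 - circ β) + l1norm v := by
      refine phiMax_le (one_sub_circ_isHermitian hm.1) fun x => ?_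
      rw [h, add_mul]
      have h1 := dotProduct_mulVec_le_phiMax_mul hA x
      have h2 := (abs_le.1 (abs_dotProduct_circ_mulVec_le v x)).1
      linarith
    have := hβ.2
    linarith

end ParameterSet

/-! ### The least squares criterion and its minimizer -/

section Criterion

open Matrix

variable {p : ℕ} [NeZero p] {n : ℕ}

/-- The contribution of one observation `x` of the field to the criterion. -/
noncomputable def obsCriterion (θ' : Param p) (x : EuclideanSpace ℝ (Lattice p)) : ℝ :=
  1 / (p : ℝ) ^ 2 * (((1 - circ θ') *ᵥ x.ofLp) ⬝ᵥ ((1 - circ θ') *ᵥ x.ofLp))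

lemma clsCriterion_eq_sampleMean (X : Fin n → EuclideanSpace ℝ (Lattice p)) {θ' : Param p}
    (hθ' : θ' ∈ Theta p) : clsCriterion X θ' = sampleMean (obsCriterion θ') X := by
  have h : ∀ x : EuclideanSpace ℝ (Lattice p),
      ((1 - circ θ') *ᵥ x.ofLp) ⬝ᵥ ((1 - circ θ') *ᵥ x.ofLp) =
        ∑ j, (x j - ∑ l ∈ Finset.univ.erase (0 : Lattice p), θ' l * x (j + l)) ^ 2 := fun x =>
    Finset.sum_congr rfl fun j _ => by
      rw [sub_mulVec, one_mulVec, Pi.sub_apply, circ_mulVec_of_mem_theta hθ', sq]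
  simp only [clsCriterion, sampleMean, obsCriterion, ← Finset.mul_sum, h]
  rw [one_div, one_div, mul_inv]
  ring

lemma continuous_uncurry_clsCriterion :
    Continuous (Function.uncurry
      (clsCriterion : (Fin n → EuclideanSpace ℝ (Lattice p)) → Param p → ℝ)) := by
  unfold clsCriterion Function.uncurry
  fun_prop

lemma obsCriterion_add_add_sub (c v : Param p) (x : EuclideanSpace ℝ (Lattice p)) :
    obsCriterion (c + v) x + obsCriterion (c - v) x = 2 * obsCriterion c x +
      2 * (1 / (p : ℝ) ^ 2 * ((circ v *ᵥ x.ofLp) ⬝ᵥ (circ v *ᵥ x.ofLp))) := by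
  simp only [obsCriterion, circ_add, circ_sub, sub_mulVec, add_mulVec, dotProduct_sub,
    sub_dotProduct, dotProduct_add, add_dotProduct]
  ring

/-- The minimizer of the criterion over a convex set of parameters is unique as soon as
convolution with one of the observations is injective. -/
lemma argmin_clsCriterion_unique (X : Fin n → EuclideanSpace ℝ (Lattice p)) {K : Set (Param p)}
    (hK : Convex ℝ K) (hKθ : K ⊆ Theta p) (i : Fin n)
    (hinj : ∀ v : Param p, (∀ x, ∑ l, v l * (X i).ofLp (x + l) = 0) → v = 0)
    {a b : Param p} (ha : a ∈ K) (hb : b ∈ K) (hamin : ∀ z ∈ K, clsCriterion X a ≤ clsCriterion X z)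
    (hbmin : ∀ z ∈ K, clsCriterion X b ≤ clsCriterion X z) : a = b := by
  -- Parallelogram identity around the midpoint `c`, which also belongs to `K`.
  set c : Param p := (1 / 2 : ℝ) • a + (1 / 2 : ℝ) • b with hc
  set v : Param p := (1 / 2 : ℝ) • a - (1 / 2 : ℝ) • b with hv
  have hcK : c ∈ K := hK ha hb (by norm_num) (by norm_num) (by norm_num)
  have hca : c + v = a := by
    rw [hc, hv, add_add_sub_cancel, ← add_smul]; norm_num
  have hcb : c - v = b := by
    rw [hc, hv, add_sub_sub_cancel, ← add_smul]; norm_num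
  have hn : (0 : ℝ) < n := by exact_mod_cast Fin.pos i
  have hp : (0 : ℝ) < p := by exact_mod_cast NeZero.pos p
  have h1 := hamin c hcK
  have h2 := hbmin c hcK
  rw [clsCriterion_eq_sampleMean X (hKθ hcK), clsCriterion_eq_sampleMean X (hKθ ha)] at h1
  rw [clsCriterion_eq_sampleMean X (hKθ hcK), clsCriterion_eq_sampleMean X (hKθ hb)] at h2
  simp only [sampleMean, div_le_div_iff_of_pos_right hn] at h1 h2
  have h3 : ∑ i, obsCriterion a (X i) + ∑ i, obsCriterion b (X i) =
      2 * ∑ i, obsCriterion c (X i) + 2 * (1 / (p : ℝ) ^ 2 *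
        ∑ i, (circ v *ᵥ (X i).ofLp) ⬝ᵥ (circ v *ᵥ (X i).ofLp)) := by
    rw [← Finset.sum_add_distrib]
    simp only [Finset.mul_sum]
    rw [← Finset.sum_add_distrib]
    exact Finset.sum_congr rfl fun i _ => by rw [← hca, ← hcb, obsCriterion_add_add_sub]
  have h4 : ∑ i, (circ v *ᵥ (X i).ofLp) ⬝ᵥ (circ v *ᵥ (X i).ofLp) ≤ 0 := by
    have : 0 < 1 / (p : ℝ) ^ 2 := by positivity
    by_contra h
    push Not at h
    nlinarith [mul_pos this h]
  have h5 : (circ v *ᵥ (X i).ofLp) ⬝ᵥ (circ v *ᵥ (X i).ofLp) = 0 :=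
    le_antisymm ((Finset.single_le_sum (f := fun i => (circ v *ᵥ (X i).ofLp) ⬝ᵥ
      (circ v *ᵥ (X i).ofLp)) (fun j _ => dotProduct_self_nonneg _)
      (Finset.mem_univ i)).trans h4) (dotProduct_self_nonneg _)
  have h6 : v = 0 := hinj v fun x => by
    rw [← circ_mulVec, dotProduct_self_eq_zero.1 h5]; rfl
  rw [← hca, ← hcb, h6]; simp

variable {m : Set (Lattice p)} {ρ : ℝ}

lemma clsEstimator_spec (hne : (ThetaModelPlusRho m ρ).Nonempty)
    (X : Fin n → EuclideanSpace ℝ (Lattice p)) :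
    clsEstimator m ρ X ∈ closure (ThetaModelPlusRho m ρ) ∧
      ∀ y ∈ closure (ThetaModelPlusRho m ρ),
        clsCriterion X (clsEstimator m ρ X) ≤ clsCriterion X y :=
  argminOn_spec isCompact_closure_thetaModelPlusRho hne.closure
    (continuous_uncurry_clsCriterion.comp (Continuous.prodMk_right X)).continuousOn

lemma continuous_loss (σ : ℝ) (θ β : Param p) : Continuous fun θ' => loss σ θ θ' β := by
  unfold loss circ
  fun_prop

instance (σ : ℝ) (θ : Param p) : IsProbabilityMeasure (dataLaw σ θ n) := by
  unfold dataLaw; infer_instance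

lemma aestronglyMeasurable_loss_clsEstimator {σ : ℝ} (hσ : 0 < σ) {θ : Param p}
    (hθ : θ ∈ ThetaPlus p) (hne : (ThetaModelPlusRho m ρ).Nonempty) (β : Param p) (hn : 1 ≤ n) :
    AEStronglyMeasurable (fun X => loss σ θ (clsEstimator m ρ X) β) (dataLaw σ θ n) := by
  refine aestronglyMeasurable_comp_argmin (t := clsEstimator m ρ)
    isCompact_closure_thetaModelPlusRho continuous_uncurry_clsCriterion
    (fun X => (clsEstimator_spec hne X).1) (fun X => (clsEstimator_spec hne X).2) ?_
    (continuous_loss σ θ β)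
  have h := (measurePreserving_eval (fun _ : Fin n => multivariateGaussian 0 (cov σ θ))
    ⟨0, hn⟩).quasiMeasurePreserving.ae (ae_convolution_injective (cov_posDef hσ hθ))
  filter_upwards [h] with X hX y hy hymin
  exact argmin_clsCriterion_unique X convex_thetaModelPlusRho.closure
    (fun a ha => (closure_subset_thetaModel ha).1) ⟨0, hn⟩ hX hy (clsEstimator_spec hne X).1 hymin
    (clsEstimator_spec hne X).2

lemma exists_loss_le (σ : ℝ) (θ β : Param p) :
    ∃ M : ℝ, ∀ a ∈ closure (ThetaModelPlusRho m ρ), |loss σ θ a β| ≤ M := by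
  obtain ⟨M, hM⟩ := isCompact_closure_thetaModelPlusRho.exists_bound_of_continuousOn
    (s := closure (ThetaModelPlusRho m ρ)) (continuous_loss σ θ β).continuousOn
  exact ⟨M, hM⟩

lemma integrable_loss_clsEstimator {σ : ℝ} (hσ : 0 < σ) {θ : Param p}
    (hθ : θ ∈ ThetaPlus p) (hne : (ThetaModelPlusRho m ρ).Nonempty) (β : Param p) (hn : 1 ≤ n) :
    Integrable (fun X => loss σ θ (clsEstimator m ρ X) β) (dataLaw σ θ n) := by
  obtain ⟨M, hM⟩ := exists_loss_le (m := m) (ρ := ρ) σ θ β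
  exact Integrable.of_bound (aestronglyMeasurable_loss_clsEstimator hσ hθ hne β hn) M
    (ae_of_all _ fun X => hM _ (clsEstimator_spec hne X).1)

end Criterion

/-! ### Scores and Hessians of the criterion -/

section Moments

open Matrix

variable {p : ℕ} [NeZero p]

lemma trace_transpose_mul_mul_eq_sum {ι : Type*} [Fintype ι] (M A : Matrix ι ι ℝ) :
    (Mᵀ * (A * M)).trace = ∑ x, (fun y => M y x) ⬝ᵥ A *ᵥ (fun y => M y x) := rfl

/-- The score of one observation in the direction `v` at the parameter `β`, that is `-1/2` times the
derivative of its criterion, is the quadratic form with this matrix. -/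
noncomputable def scoreMatrix (β v : Param p) : Matrix (Lattice p) (Lattice p) ℝ :=
  (1 / (p : ℝ) ^ 2) • (circ v * (1 - circ β))

/-- Half the Hessian of the criterion of one observation in the directions `v`, `w` is the quadratic
form with this matrix. -/
noncomputable def hessMatrix (v w : Param p) : Matrix (Lattice p) (Lattice p) ℝ :=
  (1 / (p : ℝ) ^ 2) • (circ v * circ w)

lemma isHermitian_mul_of_commute {ι : Type*} [Fintype ι] {A B : Matrix ι ι ℝ}
    (hA : A.IsHermitian) (hB : B.IsHermitian) (h : Commute A B) : (A * B).IsHermitian := by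
  rw [IsHermitian, conjTranspose_mul, hA.eq, hB.eq, h.eq]

lemma scoreMatrix_isHermitian {β v : Param p} (hβ : β ∈ Theta p) (hv : v ∈ Theta p) :
    (scoreMatrix β v).IsHermitian :=
  (isHermitian_mul_of_commute (circ_isHermitian hv) (one_sub_circ_isHermitian hβ)
    (one_sub_circ_commute v β)).smul (IsSelfAdjoint.all _)

lemma hessMatrix_isHermitian {v w : Param p} (hv : v ∈ Theta p) (hw : w ∈ Theta p) :
    (hessMatrix v w).IsHermitian :=
  (isHermitian_mul_of_commute (circ_isHermitian hv) (circ_isHermitian hw)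
    (circ_commute v w)).smul (IsSelfAdjoint.all _)

lemma cov_commute (σ : ℝ) (θ v : Param p) : Commute (circ v) (cov σ θ) :=
  (inv_commute (one_sub_circ_commute v θ)).smul_right _

lemma trace_hessMatrix_mul_cov (σ : ℝ) (θ v w : Param p) :
    (hessMatrix v w * cov σ θ).trace = lossForm σ θ v w := by
  rw [hessMatrix, Matrix.smul_mul, trace_smul, smul_eq_mul, lossForm_apply, Matrix.mul_assoc,
    (cov_commute σ θ w).eq, Matrix.mul_assoc]

/-- The score is centered at the projection. -/
lemma trace_scoreMatrix_mul_cov {σ : ℝ} {θ β v : Param p} (hθ : θ ∈ ThetaPlus p)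
    (hv : v ∈ Theta p) (hβ : lossForm σ θ v (θ - β) = 0) :
    (scoreMatrix β v * cov σ θ).trace = 0 := by
  have h1 : (1 - circ β) = (1 - circ θ) + circ (θ - β) := by rw [circ_sub]; abel
  have h2 : (1 - circ θ) * cov σ θ = σ ^ 2 • 1 := by
    rw [cov, Matrix.mul_smul, mul_nonsing_inv _ (isUnit_det_one_sub_circ hθ)]
  have h3 : (circ v).trace = 0 := by simp [trace, circ, hv.1]
  rw [← trace_hessMatrix_mul_cov, hessMatrix] at hβ
  rw [scoreMatrix, h1, Matrix.mul_add, smul_add, Matrix.add_mul, trace_add, hβ, add_zero,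
    Matrix.smul_mul, Matrix.mul_assoc, h2, Matrix.mul_smul, Matrix.mul_one, trace_smul, trace_smul,
    h3]
  simp

/-- Lower bound for the variance of the score, when `σ² (I - C(β))² ≥ c (I - C(θ))`. -/
lemma mul_lossForm_le_trace {σ c : ℝ} {θ β v : Param p} (hθ : θ ∈ ThetaPlus p)
    (hβ : β ∈ Theta p) (hv : v ∈ Theta p)
    (hc : ∀ x : Lattice p → ℝ, c * (x ⬝ᵥ (1 - circ θ) *ᵥ x) ≤
      σ ^ 2 * (((1 - circ β) *ᵥ x) ⬝ᵥ ((1 - circ β) *ᵥ x))) :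
    c * lossForm σ θ v v ≤
      (p : ℝ) ^ 2 * (scoreMatrix β v * cov σ θ * (scoreMatrix β v * cov σ θ)).trace := by
  have hp : (p : ℝ) ≠ 0 := Nat.cast_ne_zero.2 (NeZero.ne p)
  set P := 1 - circ θ with hP
  set Q := 1 - circ β with hQ
  set M := P⁻¹ * circ v with hM
  have hPP : P * P⁻¹ = 1 := mul_nonsing_inv _ (isUnit_det_one_sub_circ hθ)
  have hPM : P * M = circ v := by rw [hM, ← Matrix.mul_assoc, hPP, Matrix.one_mul]
  have hPt : Pᵀ = P := (conjTranspose_eq_transpose_of_trivial P).symm.trans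
    (one_sub_circ_isHermitian hθ.1).eq
  have hQt : Qᵀ = Q := (conjTranspose_eq_transpose_of_trivial Q).symm.trans
    (one_sub_circ_isHermitian hβ).eq
  have hcomm : circ v * P⁻¹ = M := (inv_commute (one_sub_circ_commute v θ)).eq
  have hMt : Mᵀ = M := by
    rw [hM, transpose_mul, transpose_circ hv, transpose_nonsing_inv, hPt, hcomm]
  have hQM : Q * M = M * Q := by
    have h1 : Commute Q P := (Commute.one_left _).sub_left (one_sub_circ_commute β θ)
    have h2 : Commute Q (circ v) := (one_sub_circ_commute v β).symm
    exact ((inv_commute h1).mul_right h2).eq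
  have e1 : lossForm σ θ v v = 1 / (p : ℝ) ^ 2 * (σ ^ 2 * (Mᵀ * (P * M)).trace) := by
    rw [lossForm_apply, cov, ← hP, Matrix.mul_smul, Matrix.smul_mul, trace_smul, hcomm, hPM, hMt,
      smul_eq_mul]
  have e2 : scoreMatrix β v * cov σ θ = (1 / (p : ℝ) ^ 2 * σ ^ 2) • (Q * M) := by
    rw [scoreMatrix, cov, Matrix.smul_mul, Matrix.mul_smul, smul_smul, ← hP, ← hQ,
      (one_sub_circ_commute v β).eq, Matrix.mul_assoc, hcomm]
  have e3 : (Q * M * (Q * M)).trace = (Mᵀ * (Q * Q * M)).trace := by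
    nth_rewrite 1 [hQM]
    rw [hMt]
    simp only [Matrix.mul_assoc]
  have key : c * (Mᵀ * (P * M)).trace ≤ σ ^ 2 * (Mᵀ * (Q * Q * M)).trace := by
    rw [trace_transpose_mul_mul_eq_sum, trace_transpose_mul_mul_eq_sum, Finset.mul_sum,
      Finset.mul_sum]
    refine Finset.sum_le_sum fun x _ => (hc _).trans_eq ?_
    rw [← mulVec_mulVec, dotProduct_mulVec _ Q (Q *ᵥ _), ← mulVec_transpose, hQt]
  rw [e1, e2, Matrix.smul_mul, Matrix.mul_smul, smul_smul, trace_smul, e3, smul_eq_mul]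
  have h4 : 0 ≤ σ ^ 2 / (p : ℝ) ^ 2 := by positivity
  calc _ = σ ^ 2 / (p : ℝ) ^ 2 * (c * (Mᵀ * (P * M)).trace) := by ring
    _ ≤ σ ^ 2 / (p : ℝ) ^ 2 * (σ ^ 2 * (Mᵀ * (Q * Q * M)).trace) := by gcongr
    _ = _ := by field_simp

/-- Second-order expansion of the criterion of one observation. -/
lemma obsCriterion_add_sum {d : ℕ} (β : Param p) (e : Fin d → Param p)
    (he : ∀ j, e j ∈ Theta p) (u : Fin d → ℝ) (x : EuclideanSpace ℝ (Lattice p)) :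
    obsCriterion (β + ∑ j, u j • e j) x = obsCriterion β x
      - 2 * ∑ j, u j * (x.ofLp ⬝ᵥ scoreMatrix β (e j) *ᵥ x.ofLp)
      + ∑ j, ∑ k, u j * u k * (x.ofLp ⬝ᵥ hessMatrix (e j) (e k) *ᵥ x.ofLp) := by
  have hsc : ∀ v ∈ Theta p, x.ofLp ⬝ᵥ scoreMatrix β v *ᵥ x.ofLp =
      1 / (p : ℝ) ^ 2 * ((circ v *ᵥ x.ofLp) ⬝ᵥ ((1 - circ β) *ᵥ x.ofLp)) := fun v hv => by
    rw [scoreMatrix, smul_mulVec, dotProduct_smul, smul_eq_mul, ← mulVec_mulVec,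
      dotProduct_mulVec _ (circ v), ← mulVec_transpose, transpose_circ hv]
  have hhs : ∀ v ∈ Theta p, ∀ w, x.ofLp ⬝ᵥ hessMatrix v w *ᵥ x.ofLp =
      1 / (p : ℝ) ^ 2 * ((circ v *ᵥ x.ofLp) ⬝ᵥ (circ w *ᵥ x.ofLp)) := fun v hv w => by
    rw [hessMatrix, smul_mulVec, dotProduct_smul, smul_eq_mul, ← mulVec_mulVec,
      dotProduct_mulVec _ (circ v), ← mulVec_transpose, transpose_circ hv]
  have hsum : circ (∑ j, u j • e j) *ᵥ x.ofLp = ∑ j, u j • (circ (e j) *ᵥ x.ofLp) := by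
    have : circ (∑ j, u j • e j) = ∑ j, u j • circ (e j) := by
      ext a b
      simp [circ, Matrix.sum_apply]
    rw [this, sum_mulVec]
    simp only [smul_mulVec]
  simp only [hsc _ (he _), hhs _ (he _)]
  rw [obsCriterion, obsCriterion, circ_add, ← sub_sub, sub_mulVec (1 - circ β), hsum]
  set r := (1 - circ β) *ᵥ x.ofLp
  set s : Fin d → Lattice p → ℝ := fun j => circ (e j) *ᵥ x.ofLp
  have h1 : (∑ j, u j • s j) ⬝ᵥ r = ∑ j, u j * (s j ⬝ᵥ r) := by
    simp [sum_dotProduct]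
  have h2 : (∑ j, u j • s j) ⬝ᵥ (∑ j, u j • s j) = ∑ j, ∑ k, u j * u k * (s j ⬝ᵥ s k) := by
    rw [sum_dotProduct]
    refine Finset.sum_congr rfl fun j _ => ?_
    rw [smul_dotProduct, dotProduct_sum, smul_eq_mul, Finset.mul_sum]
    exact Finset.sum_congr rfl fun k _ => by rw [dotProduct_smul, smul_eq_mul]; ring
  have h3 : (r - ∑ j, u j • s j) ⬝ᵥ (r - ∑ j, u j • s j) =
      r ⬝ᵥ r - 2 * ((∑ j, u j • s j) ⬝ᵥ r) + (∑ j, u j • s j) ⬝ᵥ (∑ j, u j • s j) := by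
    rw [sub_dotProduct, dotProduct_sub, dotProduct_sub, dotProduct_comm r (∑ j, u j • s j)]
    ring
  rw [h3, h1, h2, mul_add, mul_sub]
  simp only [Finset.mul_sum]
  congr 1
  · congr 1
    exact Finset.sum_congr rfl fun j _ => by ring
  · exact Finset.sum_congr rfl fun j _ => Finset.sum_congr rfl fun k _ => by ring

end Moments

/-! ### Linearity of sample means -/

section SampleMean

variable {Ω : Type*} {n : ℕ}

lemma sampleMean_add (f g : Ω → ℝ) (X : Fin n → Ω) :
    sampleMean (fun x => f x + g x) X = sampleMean f X + sampleMean g X := by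
  simp only [sampleMean, Finset.sum_add_distrib, add_div]

lemma sampleMean_const_mul (c : ℝ) (f : Ω → ℝ) (X : Fin n → Ω) :
    sampleMean (fun x => c * f x) X = c * sampleMean f X := by
  simp only [sampleMean, ← Finset.mul_sum, mul_div_assoc]

lemma sampleMean_sum {ι : Type*} (s : Finset ι) (f : ι → Ω → ℝ) (X : Fin n → Ω) :
    sampleMean (fun x => ∑ j ∈ s, f j x) X = ∑ j ∈ s, sampleMean (f j) X := by
  simp only [sampleMean, ← Finset.sum_div]
  rw [Finset.sum_comm]

lemma sampleMean_const (hn : 1 ≤ n) (c : ℝ) (X : Fin n → Ω) :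
    sampleMean (fun _ => c) X = c := by
  have : (n : ℝ) ≠ 0 := by positivity
  simp [sampleMean, this]

end SampleMean

/-! ### Bilinear forms in coordinates -/

section BilinearForm

open scoped RealInnerProductSpace

variable {d : ℕ}

/-- The bilinear form on `ℝ^d` with matrix `H`. -/
noncomputable def coordForm (H : Fin d → Fin d → ℝ) :
    LinearMap.BilinForm ℝ (EuclideanSpace ℝ (Fin d)) :=
  LinearMap.mk₂ ℝ (fun u v => ∑ j, ∑ k, u j * v k * H j k)
    (fun a b w => by simp only [PiLp.add_apply, add_mul, Finset.sum_add_distrib])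
    (fun c a w => by
      simp only [PiLp.smul_apply, smul_eq_mul, Finset.mul_sum, mul_assoc])
    (fun a b w => by simp only [PiLp.add_apply, add_mul, mul_add, Finset.sum_add_distrib])
    (fun c a w => by
      simp only [PiLp.smul_apply, smul_eq_mul, Finset.mul_sum]
      exact Finset.sum_congr rfl fun j _ => Finset.sum_congr rfl fun k _ => by ring)

lemma coordForm_apply (H : Fin d → Fin d → ℝ) (u v : EuclideanSpace ℝ (Fin d)) :
    coordForm H u v = ∑ j, ∑ k, u j * v k * H j k := rfl

lemma abs_coordForm_le (H : Fin d → Fin d → ℝ) (u v : EuclideanSpace ℝ (Fin d)) :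
    |coordForm H u v| ≤ √(∑ jk : Fin d × Fin d, H jk.1 jk.2 ^ 2) * ‖u‖ * ‖v‖ := by
  have h : coordForm H u v = ∑ jk : Fin d × Fin d, H jk.1 jk.2 * (u jk.1 * v jk.2) := by
    rw [coordForm_apply, Fintype.sum_prod_type]
    exact Finset.sum_congr rfl fun j _ => Finset.sum_congr rfl fun k _ => by ring
  have hs : ∑ jk : Fin d × Fin d, (u jk.1 * v jk.2) ^ 2 = ‖u‖ ^ 2 * ‖v‖ ^ 2 := by
    rw [Fintype.sum_prod_type, EuclideanSpace.real_norm_sq_eq, EuclideanSpace.real_norm_sq_eq,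
      Finset.sum_mul_sum]
    simp only [mul_pow]
  have hcs := Finset.sum_mul_sq_le_sq_mul_sq Finset.univ
    (fun jk : Fin d × Fin d => H jk.1 jk.2) (fun jk => u jk.1 * v jk.2)
  rw [hs, ← h] at hcs
  refine abs_le_of_sq_le_sq ?_ (by positivity)
  rw [mul_pow, mul_pow, Real.sq_sqrt (Finset.sum_nonneg fun _ _ => sq_nonneg _), mul_assoc]
  exact hcs

end BilinearForm

/-! ### Asymptotic risk -/

section Risk

open Matrix
open scoped RealInnerProductSpace

variable {p : ℕ} [NeZero p]

/-- Asymptotic risk of the estimator around the projection `β` of `θ` on the model, when `β` lies in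
the interior of the parameter set. In coordinates orthonormal for the loss, the estimation error is
the mean of the scores up to terms of higher order, so that the risk is asymptotically the sum of
the variances of the scores. -/
theorem exists_tendsto_clsRisk {σ ρ c : ℝ} {m : Set (Lattice p)} {θ β : Param p} (hσ : 0 < σ)
    (hθ : θ ∈ ThetaPlus p) (hβ : β ∈ ThetaModelPlusRho m ρ)
    (hproj : ∀ w ∈ ThetaModel m, lossForm σ θ w (θ - β) = 0)
    (hc : ∀ x : Lattice p → ℝ, c * (x ⬝ᵥ (1 - circ θ) *ᵥ x) ≤
      σ ^ 2 * (((1 - circ β) *ᵥ x) ⬝ᵥ ((1 - circ β) *ᵥ x))) :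
    ∃ R : ℝ, Tendsto (fun n : ℕ => (n : ℝ) * (p : ℝ) ^ 2 * clsRisk σ θ m ρ β n) atTop (𝓝 R) ∧
      varSqGaussian * c * dimModel m ≤ R := by
  have hp : (0 : ℝ) < p := by exact_mod_cast NeZero.pos p
  have hS := (cov_posDef hσ hθ).posSemidef
  have hβm : β ∈ ThetaModel m := hβ.1.1
  obtain ⟨e, he⟩ := exists_basis_orthonormal_lossForm hσ hθ m
  have heθ : ∀ j, (e j : Param p) ∈ Theta p := fun j => (e j).2.1
  set P := multivariateGaussian 0 (cov σ θ) with hP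
  set g : Fin (dimModel m) → EuclideanSpace ℝ (Lattice p) → ℝ :=
    fun j x => x.ofLp ⬝ᵥ scoreMatrix β (e j) *ᵥ x.ofLp with hg
  set a : Fin (dimModel m) × Fin (dimModel m) → EuclideanSpace ℝ (Lattice p) → ℝ :=
    fun jk x => x.ofLp ⬝ᵥ hessMatrix (e jk.1) (e jk.2 : Param p) *ᵥ x.ofLp -
      if jk.1 = jk.2 then 1 else 0 with ha
  have hgm : ∀ j, Measurable (g j) := fun j => measurable_quadraticForm _
  have ham : ∀ jk, Measurable (a jk) := fun jk => (measurable_quadraticForm _).sub_const _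
  have hg4 : ∀ j, MemLp (g j) 4 P := fun j => memLp_quadraticForm_multivariateGaussian _
  have ha4 : ∀ jk, MemLp (a jk) 4 P := fun jk =>
    (memLp_quadraticForm_multivariateGaussian _).sub (memLp_const _)
  have hg0 : ∀ j, ∫ x, g j x ∂P = 0 := fun j => by
    rw [hP, integral_quadraticForm_multivariateGaussian hS
      (scoreMatrix_isHermitian hβm.1 (heθ j)),
      trace_scoreMatrix_mul_cov hθ (heθ j) (hproj _ (e j).2)]
  have ha0 : ∀ jk, ∫ x, a jk x ∂P = 0 := fun jk => by
    have hi : Integrable (fun x : EuclideanSpace ℝ (Lattice p) =>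
        x.ofLp ⬝ᵥ hessMatrix (e jk.1) (e jk.2 : Param p) *ᵥ x.ofLp) P :=
      (memLp_quadraticForm_multivariateGaussian _).integrable (by norm_num)
    rw [ha, integral_sub hi (integrable_const _), hP,
      integral_quadraticForm_multivariateGaussian hS (hessMatrix_isHermitian (heθ _) (heθ _)),
      trace_hessMatrix_mul_cov, he, integral_const, probReal_univ, one_smul, sub_self]
  -- `Φ u` is the element of the model with coordinates `u`.
  set Φ : EuclideanSpace ℝ (Fin (dimModel m)) → Param p := fun u => ∑ j, u j • (e j : Param p)
    with hΦ
  have hΦm : ∀ u, Φ u ∈ ThetaModel m := fun u =>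
    sum_mem fun j _ => Submodule.smul_mem _ _ (e j).2
  have hΦnorm : ∀ u, lossForm σ θ (Φ u) (Φ u) = ‖u‖ ^ 2 := fun u => by
    simp only [hΦ, map_sum, map_smul, LinearMap.sum_apply, LinearMap.smul_apply, smul_eq_mul, he]
    rw [EuclideanSpace.real_norm_sq_eq]
    simp [sq]
  have hΦsurj : ∀ v ∈ ThetaModel m, ∃ u, Φ u = v := fun v hv =>
    ⟨WithLp.toLp 2 (e.repr ⟨v, hv⟩), by
      have h := congrArg Subtype.val (e.sum_repr ⟨v, hv⟩)
      rw [Submodule.coe_sum] at h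
      exact h⟩
  have hne : (ThetaModelPlusRho m ρ).Nonempty := ⟨β, hβ⟩
  set K := closure (ThetaModelPlusRho m ρ) with hK
  -- In coordinates, `K - β` contains a ball around the origin and is bounded.
  obtain ⟨ε, hε, hball⟩ : ∃ ε > 0, ∀ u, ‖u‖ ≤ ε → β + Φ u ∈ K := by
    obtain ⟨δ, hδ, hball⟩ := exists_add_mem_thetaModelPlusRho hβ
    set A := ∑ j, l1norm (e j : Param p) with hA
    have hA0 : 0 ≤ A := Finset.sum_nonneg fun j _ => Finset.sum_nonneg fun x _ => abs_nonneg _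
    refine ⟨δ / (A + 1), by positivity, fun u hu => subset_closure (hball _ (hΦm u) ?_)⟩
    have h1 : l1norm (Φ u) ≤ ∑ j, |u j| * l1norm (e j : Param p) := by
      simp only [l1norm, hΦ, Finset.mul_sum]
      rw [Finset.sum_comm]
      refine Finset.sum_le_sum fun x _ => ?_
      simp only [Finset.sum_apply, Pi.smul_apply, smul_eq_mul, ← abs_mul]
      exact Finset.abs_sum_le_sum_abs _ _
    have h2 : ∑ j, |u j| * l1norm (e j : Param p) ≤ ‖u‖ * A := by
      rw [hA, Finset.mul_sum]
      refine Finset.sum_le_sum fun j _ => ?_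
      have : |u j| ≤ ‖u‖ := PiLp.norm_apply_le u j
      exact mul_le_mul_of_nonneg_right this (Finset.sum_nonneg fun x _ => abs_nonneg _)
    rw [le_div_iff₀ (by positivity)] at hu
    nlinarith [norm_nonneg u]
  obtain ⟨M, hM⟩ := exists_loss_le (m := m) (ρ := ρ) σ θ β
  have hMK : ∀ u, β + Φ u ∈ K → ‖u‖ ^ 2 ≤ M := fun u hu => by
    have := (le_abs_self _).trans (hM _ hu)
    rwa [loss_eq_lossForm, add_sub_cancel_left, hΦnorm] at this
  have hM0 : 0 ≤ M := by
    have h0 : Φ 0 = 0 := by simp [hΦ]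
    exact (sq_nonneg _).trans (hMK 0 (by rw [h0, add_zero]; exact subset_closure hβ))
  have hlim := tendsto_integral_of_abs_sub_sum_sq_le P hgm ham hg4 ha4 hg0 ha0
    (T := fun n X => loss σ θ (clsEstimator m ρ X) β)
    (fun n hn => integrable_loss_clsEstimator hσ hθ hne β hn)
    (C := 20 + 16 * M + M * (8 / ε) ^ 4 + (8 / ε) ^ 2) (by positivity) ?_
  · refine ⟨(p : ℝ) ^ 2 * ∑ j, ∫ x, g j x ^ 2 ∂P, ?_, ?_⟩
    · refine (hlim.const_mul ((p : ℝ) ^ 2)).congr fun n => ?_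
      rw [clsRisk, dataLaw]; ring
    · rw [Finset.mul_sum]
      have hj : ∀ j, varSqGaussian * c ≤ (p : ℝ) ^ 2 * ∫ x, g j x ^ 2 ∂P := fun j => by
        have h1 := variance_quadraticForm_multivariateGaussian hS
          (scoreMatrix_isHermitian hβm.1 (heθ j))
        rw [variance_of_integral_eq_zero (hgm j).aemeasurable (hg0 j)] at h1
        rw [h1]
        have h2 := mul_lossForm_le_trace hθ hβm.1 (heθ j) hc
        rw [he, if_pos rfl, mul_one] at h2
        nlinarith [varSqGaussian_pos]
      calc varSqGaussian * c * dimModel m = ∑ _j : Fin (dimModel m), varSqGaussian * c := by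
            simp; ring
        _ ≤ _ := Finset.sum_le_sum fun j _ => hj j
  · refine fun n hn => ae_of_all _ fun X => ?_
    set H : Fin (dimModel m) → Fin (dimModel m) → ℝ := fun j k => sampleMean (a (j, k)) X with hH
    set G : EuclideanSpace ℝ (Fin (dimModel m)) := WithLp.toLp 2 fun j => sampleMean (g j) X
      with hG
    -- The criterion is a quadratic function of the coordinates.
    have hcrit : ∀ u, clsCriterion X (β + Φ u) =
        clsCriterion X β + (-2 * ⟪G, u⟫ + ‖u‖ ^ 2 + coordForm H u u) := fun u => by
      rw [clsCriterion_eq_sampleMean X (add_mem hβm.1 (hΦm u).1),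
        clsCriterion_eq_sampleMean X hβm.1]
      have hpt : obsCriterion (β + Φ u) = fun x => obsCriterion β x +
          ((-2) * ∑ j, u j * g j x + (∑ j, ∑ k, u j * u k * a (j, k) x + ‖u‖ ^ 2)) := by
        funext x
        rw [hΦ, obsCriterion_add_sum β _ heθ, EuclideanSpace.real_norm_sq_eq]
        have : ∑ j, ∑ k, u j * u k * a (j, k) x =
            ∑ j, ∑ k, u j * u k * (x.ofLp ⬝ᵥ hessMatrix (e j) (e k : Param p) *ᵥ x.ofLp) -
              ∑ j, u j ^ 2 := by
          simp [ha, mul_sub, Finset.sum_sub_distrib, sq]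
        rw [this]; ring
      rw [hpt, sampleMean_add, sampleMean_add, sampleMean_add, sampleMean_const_mul,
        sampleMean_sum, sampleMean_sum, sampleMean_const hn]
      simp only [sampleMean_sum, sampleMean_const_mul]
      have hin : ⟪G, u⟫ = ∑ j, u j * sampleMean (g j) X := by
        simp [hG, PiLp.inner_apply]
      rw [hin, coordForm_apply]; ring
    obtain ⟨u, hu⟩ := hΦsurj (clsEstimator m ρ X - β)
      (sub_mem (closure_subset_thetaModel (clsEstimator_spec hne X).1) hβm)
    have hest : clsEstimator m ρ X = β + Φ u := by rw [hu, add_sub_cancel]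
    have hT : loss σ θ (clsEstimator m ρ X) β = ‖u‖ ^ 2 := by
      rw [loss_eq_lossForm, ← hu, hΦnorm]
    have hG2 : ∑ j, sampleMean (g j) X ^ 2 = ‖G‖ ^ 2 := by
      rw [EuclideanSpace.real_norm_sq_eq]
    have hN0 : 0 ≤ ∑ jk, sampleMean (a jk) X ^ 2 := Finset.sum_nonneg fun _ _ => sq_nonneg _
    have hsymm : ∀ u v, coordForm H u v = coordForm H v u := fun u v => by
      rw [coordForm_apply, coordForm_apply, Finset.sum_comm]
      refine Finset.sum_congr rfl fun j _ => Finset.sum_congr rfl fun k _ => ?_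
      have : a (k, j) = a (j, k) := by
        simp only [ha, hessMatrix, (circ_commute (e k : Param p) (e j)).eq, eq_comm]
      simp only [hH, this]; ring
    have hmain := abs_norm_sq_argmin_sub_le (K := {u | β + Φ u ∈ K}) hε hball hMK (coordForm H)
      hsymm (Real.sqrt_nonneg (∑ jk : Fin (dimModel m) × Fin (dimModel m), H jk.1 jk.2 ^ 2))
      (abs_coordForm_le H) G u (by
        change β + Φ u ∈ K
        rw [← hest]; exact (clsEstimator_spec hne X).1) fun v hv => by
        have := (clsEstimator_spec hne X).2 _ hv
        rw [hest, hcrit, hcrit] at this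
        linarith
    rw [hT, hG2]
    refine hmain.trans_eq ?_
    have h4 : √(∑ jk : Fin (dimModel m) × Fin (dimModel m), H jk.1 jk.2 ^ 2) ^ 4 =
        (∑ jk, sampleMean (a jk) X ^ 2) ^ 2 := by
      rw [show (4 : ℕ) = 2 * 2 from rfl, pow_mul, Real.sq_sqrt hN0]
    rw [h4]
    ring

/-- The orthogonal projection of `θ` on the whole model, when it belongs to `Θ⁺_{m,ρ}`, is also the
minimizer of the loss over the closure of that set. -/
lemma proj_eq {σ ρ : ℝ} {m : Set (Lattice p)} {θ β : Param p}
    (hσ : 0 < σ) (hθ : θ ∈ ThetaPlus p) (hβ : β ∈ ThetaModelPlusRho m ρ)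
    (hproj : ∀ w ∈ ThetaModel m, lossForm σ θ w (θ - β) = 0) : proj σ m ρ θ = β := by
  have hspec := argminOn_spec (f := fun θ' => loss σ θ θ' θ)
    isCompact_closure_thetaModelPlusRho ⟨β, subset_closure hβ⟩ (continuous_loss σ θ θ).continuousOn
  change proj σ m ρ θ ∈ _ ∧ ∀ y ∈ _, loss σ θ (proj σ m ρ θ) θ ≤ _ at hspec
  obtain ⟨hm, hle⟩ := hspec
  set π := proj σ m ρ θ
  have hd : π - β ∈ ThetaModel m := sub_mem (closure_subset_thetaModel hm) hβ.1.1
  have h1 := hle β (subset_closure hβ)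
  have e1 : π - θ = (π - β) - (θ - β) := by abel
  have e2 : β - θ = -(θ - β) := by abel
  have hs : lossForm σ θ (θ - β) (π - β) = 0 := by
    rw [lossForm_symm hθ (sub_mem hθ.1 hβ.1.1.1) hd.1, hproj _ hd]
  simp only [loss_eq_lossForm, e1, e2, map_sub, map_neg, LinearMap.sub_apply, LinearMap.neg_apply]
    at h1 hs
  have h2 := hproj _ hd
  by_contra hne
  have h3 := lossForm_pos hσ hθ hd.1 (sub_ne_zero.2 hne)
  simp only [map_sub, LinearMap.sub_apply] at h2 h3
  linarith

end Risk

end TorusGMRF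

open TorusGMRF Matrix

theorem mainTheorem5 :
    ∃ L : ℝ, 0 < L ∧
      ∀ (p : ℕ) [NeZero p] (σ ρ₁ : ℝ) (m : Set (TorusGMRF.Lattice p)) (θ : TorusGMRF.Param p),
        0 < σ → 2 ≤ ρ₁ → TorusGMRF.IsModel m →
        (θ ∈ TorusGMRF.ThetaModelPlus m →
          TorusGMRF.phiMax (1 - TorusGMRF.circ θ) < ρ₁ →
          (∀ n : ℕ, 1 ≤ n → Integrable
            (fun X => TorusGMRF.loss σ θ (TorusGMRF.clsEstimator m ρ₁ X) θ)
            (TorusGMRF.dataLaw σ θ n)) ∧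
          (∃ R : ℝ,
            Tendsto (fun n : ℕ => (n : ℝ) * (p : ℝ) ^ 2 * TorusGMRF.clsRisk σ θ m ρ₁ θ n)
              atTop (𝓝 R) ∧
            L * σ ^ 2 * TorusGMRF.phiMin (1 - TorusGMRF.circ θ) * TorusGMRF.dimModel m ≤ R) ∧
          L * σ ^ 2 * TorusGMRF.phiMin (1 - TorusGMRF.circ θ) * TorusGMRF.dimModel m =
            L * σ ^ 4 * (TorusGMRF.dimModel m / TorusGMRF.phiMax (TorusGMRF.cov σ θ))) ∧
        (θ ∈ TorusGMRF.ThetaPlus p →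
          TorusGMRF.l1norm θ < 1 →
          (∀ n : ℕ, 1 ≤ n → Integrable
            (fun X => TorusGMRF.loss σ θ (TorusGMRF.clsEstimator m ρ₁ X)
              (TorusGMRF.proj σ m ρ₁ θ))
            (TorusGMRF.dataLaw σ θ n)) ∧
          ∃ R : ℝ,
            Tendsto (fun n : ℕ => (n : ℝ) * (p : ℝ) ^ 2 *
                TorusGMRF.clsRisk σ θ m ρ₁ (TorusGMRF.proj σ m ρ₁ θ) n)
              atTop (𝓝 R) ∧
            L * σ ^ 2 * (1 - TorusGMRF.l1norm θ) ^ 3 * TorusGMRF.dimModel m ≤ R) := by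
  refine ⟨varSqGaussian / 2, half_pos varSqGaussian_pos, ?_⟩
  intro p _ σ ρ₁ m θ hσ hρ _
  have hV := varSqGaussian_pos
  have hd0 : (0 : ℝ) ≤ dimModel m := Nat.cast_nonneg _
  refine ⟨fun hθ hmax => ?_, fun hθ h1 => ?_⟩
  · have hmem : θ ∈ ThetaModelPlusRho m ρ₁ := ⟨hθ, hmax⟩
    have hφ := phiMin_pos hθ.2.2
    have hσφ : 0 ≤ σ ^ 2 * phiMin (1 - circ θ) * dimModel m := by positivity
    refine ⟨fun n hn => integrable_loss_clsEstimator hσ hθ.2 ⟨θ, hmem⟩ θ hn, ?_, ?_⟩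
    · obtain ⟨R, hR, hle⟩ := exists_tendsto_clsRisk (c := σ ^ 2 * phiMin (1 - circ θ)) hσ hθ.2
        hmem (fun w _ => by rw [sub_self, map_zero]) fun x => by
          rw [mul_assoc]
          exact mul_le_mul_of_nonneg_left (mul_dotProduct_mulVec_le hφ
            (phiMin_mul_dotProduct_le (one_sub_circ_isHermitian hθ.1.1) x)) (sq_nonneg σ)
      exact ⟨R, hR, by nlinarith⟩
    · rw [cov, phiMax_smul_inv hθ.2.2 (by positivity)]
      field_simp
  · obtain ⟨β, hβ, hproj, hβ1⟩ := exists_projection_l1norm_le hσ hθ h1 m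
    have hβs := one_sub_circ_isHermitian hβ.1
    have hlow : ∀ x, (1 - l1norm θ) * (x ⬝ᵥ x) ≤ x ⬝ᵥ (1 - circ β) *ᵥ x := fun x => by
      rw [dotProduct_one_sub_circ_mulVec]
      have h2 := (abs_le.1 (abs_dotProduct_circ_mulVec_le β x)).2
      nlinarith [dotProduct_self_nonneg x]
    have hmem : β ∈ ThetaModelPlusRho m ρ₁ := by
      refine ⟨⟨hβ, hβ.1, PosDef.of_dotProduct_mulVec_pos hβs fun x hx => ?_⟩, ?_⟩
      · rw [star_trivial]
        exact (mul_pos (sub_pos.2 h1) (dotProduct_self_pos hx)).trans_le (hlow x)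
      · -- The largest eigenvalue is at most `1 + ‖θ‖₁ < 2 ≤ ρ₁`.
        have : phiMax (1 - circ β) ≤ 1 + l1norm θ := phiMax_le hβs fun x => by
          rw [dotProduct_one_sub_circ_mulVec]
          have h2 := (abs_le.1 (abs_dotProduct_circ_mulVec_le β x)).1
          nlinarith [dotProduct_self_nonneg x]
        linarith
    rw [proj_eq hσ hθ hmem hproj]
    refine ⟨fun n hn => integrable_loss_clsEstimator hσ hθ ⟨β, hmem⟩ β hn, ?_⟩
    have h0 : 0 ≤ l1norm θ := Finset.sum_nonneg fun x _ => abs_nonneg _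
    have h1' : 0 < 1 - l1norm θ := sub_pos.2 h1
    -- `(I - C(β))² ≥ (1 - ‖θ‖₁)²` while `I - C(θ) ≤ 1 + ‖θ‖₁ ≤ 2`.
    obtain ⟨R, hR, hle⟩ := exists_tendsto_clsRisk (c := σ ^ 2 * ((1 - l1norm θ) ^ 2 / 2)) hσ hθ
      hmem hproj fun x => by
        rw [mul_assoc]
        refine mul_le_mul_of_nonneg_left ?_ (sq_nonneg σ)
        have h2 := sq_mul_dotProduct_le_of_mul_dotProduct_le h1' (hlow x)
        have h3 : x ⬝ᵥ (1 - circ θ) *ᵥ x ≤ 2 * (x ⬝ᵥ x) := by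
          rw [dotProduct_one_sub_circ_mulVec]
          have h2 := (abs_le.1 (abs_dotProduct_circ_mulVec_le θ x)).1
          nlinarith [dotProduct_self_nonneg x]
        nlinarith [sq_nonneg (1 - l1norm θ)]
    refine ⟨R, hR, le_trans ?_ hle⟩
    have h4 : (1 - l1norm θ) ^ 3 ≤ (1 - l1norm θ) ^ 2 :=
      pow_le_pow_of_le_one h1'.le (by linarith) (by norm_num)
    calc varSqGaussian / 2 * σ ^ 2 * (1 - l1norm θ) ^ 3 * dimModel m
        ≤ varSqGaussian / 2 * σ ^ 2 * (1 - l1norm θ) ^ 2 * dimModel m := by gcongr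
      _ = _ := by ring
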